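/- Conventions. Manifolds are finite-dimensional, smooth, Hausdorff, second countable and without boundary. A smooth groupoid $G$ has manifolds $G_0$ of objects and $G_1$ of arrows, smooth structure maps, and submersions $s,t:G_1\to G_0$; the composite $gh$ is defined when $s(g)=t(h)$. $G$ is an orbifold groupoid if $s$ is a local diffeomorphism and $(s,t):G_1\to G_0\times G_0$ is proper. It is connected if the quotient space $G_0/G$ is connected. $S_G=\{g: s(g)=t(g)\}$, $S^0_G\subset S_G$ is the set of those $g$ whose induced germ of a diffeomorphism of $G_0$ at $s(g)$ is the germ of the identity, and $S^0_G(x)$ is the group of elements of $S^0_G$ based at $x$. $G$ is purely ineffective if $S^0_G=S_G$. A right action of a Lie group $L$ on $G$ consists of smooth right actions on $G_0$ and $G_1$ compatible with the structure maps; the semidirect product $G\rtimes L$ has objects $G_0$, arrows $G_1\times L$, $s(g,l)=s(g)\cdot l$, $t(g,l)=t(g)$ and $(g,l)(g',l')=(g(g'\cdot l^{-1}),ll')$. An equivalence between smooth groupoids $G$, $H$ is a manifold $P$ with commuting left $G$- and right $H$-actions along smooth maps $s_P:P\to G_0$ and $t_P:P\to H_0$, such that $s_P$ is a principal $H$-bundle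 and $t_P$ is a principal $G$-bundle; it is $K$-equivariant (for right $K$-actions on $G$ and $H$) if $P$ carries a smooth right $K$-action for which $s_P,t_P$ are equivariant and $(gp)\cdot k=(g\cdot k)(p\cdot k)$, $(ph)\cdot k=(p\cdot k)(h\cdot k)$. Proposition. Let $G$ be a connected purely ineffective orbifold groupoid, let $K$ be a Lie group acting on $G$ on the right, let $x\in G_0$, and let $T=S^0_G(x)$ (a finite group). Then there is a purely ineffective orbifold groupoid $G'$ with a right action of $K\times\mathrm{Aut}(T)$ ($\mathrm{Aut}(T)$ being discrete) such that: (1) $G'\rtimes\mathrm{Aut}(T)$, with the $K$-action $(g,\lambda)\cdot k=(g\cdot k,\lambda)$, is $K$-equivariantly equivalent to $G$; (2) the local system of groups $S^0_{G'}$ over $G'_0$ is $(G',K\times\mathrm{Aut}(T))$-equivariantly isomorphic to $G'_0\times Z(T)$. That is, there is a diffeomorphism $c:G'_0\times Z(T)\to S^0_{G'}$ over $G'_0$ (with $Z(T)$ discrete) that is a group isomorphism on each fibre and satisfies $g^{-1}c(t(g),a)g=c(s(g),a)$ for $g\in G'_1$ and $c(y,a)\cdot(k,\lambda)=c(y\cdot(k,\lambda),\lambda^{-1}(a))$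 for $k\in K$, $\lambda\in\mathrm{Aut}(T)$. In particular the groups $S^0_{G'}(y)$ are abelian, and $S^0_{G'}$ is $(G',K)$-equivariantly isomorphic to $G'_0\times Z(T)$ with $K$ acting trivially on $Z(T)$. -/

import Mathlib

open scoped Manifold ContDiff Topology

universe u v w

noncomputable section

/-! ### Manifolds and smooth maps on fibre products -/

/-- A smooth manifold: finite-dimensional, without boundary, Hausdorff and second countable. -/
structure Mfd where
  E : Type
  [normE : NormedAddCommGroup E]
  [spaceE : NormedSpace ℝ E]
  [finE : FiniteDimensional ℝ E]
  H : Type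
  [topH : TopologicalSpace H]
  I : ModelWithCorners ℝ E H
  [bdryless : I.Boundaryless]
  carrier : Type u
  [top : TopologicalSpace carrier]
  [charted : ChartedSpace H carrier]
  [smooth : IsManifold I ∞ carrier]
  [t2 : T2Space carrier]
  [secondCountable : SecondCountableTopology carrier]

namespace Mfd

instance : CoeSort Mfd.{u} (Type u) := ⟨Mfd.carrier⟩

attribute [instance] normE spaceE finE topH bdryless top charted smooth t2 secondCountable

/-- The product manifold. -/
abbrev prod (M : Mfd.{u}) (N : Mfd.{v}) : Mfd.{max u v} where
  E := M.E × N.E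
  H := ModelProd M.H N.H
  I := M.I.prod N.I
  carrier := M × N

/-- The manifold underlying a (Hausdorff, second countable) Lie group. -/
abbrev ofLie {E : Type} [NormedAddCommGroup E] [NormedSpace ℝ E] [FiniteDimensional ℝ E]
    {H : Type} [TopologicalSpace H] (I : ModelWithCorners ℝ E H) [I.Boundaryless]
    (L : Type v) [TopologicalSpace L] [ChartedSpace H L] [Group L] [LieGroup I ∞ L]
    [T2Space L] [SecondCountableTopology L] : Mfd.{v} :=
  haveI : IsManifold I ∞ L := ‹LieGroup I ∞ L›.toIsManifold
  { E := E, H := H, I := I, carrier := L }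

end Mfd

section Smoothness

variable {E E' : Type*} [NormedAddCommGroup E] [NormedSpace ℝ E]
  [NormedAddCommGroup E'] [NormedSpace ℝ E']
  {H H' : Type*} [TopologicalSpace H] [TopologicalSpace H']
  (I : ModelWithCorners ℝ E H) (J : ModelWithCorners ℝ E' H')
  {M N : Type*} [TopologicalSpace M] [ChartedSpace H M] [TopologicalSpace N] [ChartedSpace H' N]

/-- A map defined on a subset `A` of a manifold is smooth if locally it extends to a smooth map
on an open subset of the manifold. If `A` is an embedded submanifold (all fibre products below
are), this is smoothness for the submanifold structure on `A`. -/
def SmoothOnSubset (A : Set M) (f : A → N) : Prop :=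
  ∀ x : A, ∃ U : Set M, IsOpen U ∧ (x : M) ∈ U ∧ ∃ F : M → N,
    ContMDiffOn I J ∞ F U ∧ ∀ y : A, (y : M) ∈ U → F y = f y

/-- A diffeomorphism between two subsets of manifolds. -/
def IsDiffeoOfSubsets {A : Set M} {B : Set N} (f : A → B) : Prop :=
  ∃ e : A ≃ B, (∀ a, e a = f a) ∧ SmoothOnSubset I J A (fun a => (e a : N)) ∧
    SmoothOnSubset J I B (fun b => (e.symm b : M))

/-- A submersion: a smooth map all of whose differentials are surjective. -/
def IsSmoothSubmersion (f : M → N) : Prop :=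
  ContMDiff I J ∞ f ∧ ∀ x, Function.Surjective (mfderiv I J f x)

end Smoothness

/-- The type `A` with the discrete topology, as a zero-dimensional manifold. -/
def Disc (A : Type u) : Type u := A

namespace Disc

instance (A : Type u) : TopologicalSpace (Disc A) := ⊥
instance (A : Type u) : DiscreteTopology (Disc A) := ⟨rfl⟩
instance (A : Type u) [h : Group A] : Group (Disc A) := h
instance (A : Type u) [h : Countable A] : Countable (Disc A) := h

/-- The model of zero-dimensional manifolds. -/
abbrev model : ModelWithCorners ℝ (EuclideanSpace ℝ (Fin 0)) (EuclideanSpace ℝ (Fin 0)) := 𝓡 0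

instance : Unique (EuclideanSpace ℝ (Fin 0)) := ⟨⟨0⟩, fun _ => Subsingleton.elim _ _⟩

instance (A : Type u) : ChartedSpace (EuclideanSpace ℝ (Fin 0)) (Disc A) :=
  ChartedSpace.ofDiscreteTopology

instance (A : Type u) : IsManifold model ∞ (Disc A) := IsManifold.of_discreteTopology _

instance (A : Type u) [Countable A] : SecondCountableTopology (Disc A) := inferInstance

instance (A : Type u) [Group A] : LieGroup model ∞ (Disc A) where
  contMDiff_mul := by
    have : DiscreteTopology (Disc A × Disc A) := inferInstance
    exact contMDiff_of_discreteTopology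
  contMDiff_inv := contMDiff_of_discreteTopology

end Disc

/-! ### Smooth groupoids -/

/-- A smooth groupoid: an arrow `g` goes from `src g` to `tgt g`, and `mul g h` is the composite
`g h`, defined when `src g = tgt h`. -/
structure SmoothGroupoid where
  Obj : Mfd.{u}
  Arr : Mfd.{u}
  src : Arr → Obj
  tgt : Arr → Obj
  unit : Obj → Arr
  inv : Arr → Arr
  mul : (g h : Arr) → src g = tgt h → Arr
  src_unit : ∀ x, src (unit x) = x
  tgt_unit : ∀ x, tgt (unit x) = x
  src_inv : ∀ g, src (inv g) = tgt g
  tgt_inv : ∀ g, tgt (inv g) = src g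
  src_mul : ∀ g h e, src (mul g h e) = src h
  tgt_mul : ∀ g h e, tgt (mul g h e) = tgt g
  mul_assoc : ∀ g h k (e : src g = tgt h) (e' : src h = tgt k),
    mul g (mul h k e') (e.trans (tgt_mul h k e').symm) =
      mul (mul g h e) k ((src_mul g h e).trans e')
  mul_unit : ∀ g, mul g (unit (src g)) (tgt_unit (src g)).symm = g
  unit_mul : ∀ g, mul (unit (tgt g)) g (src_unit (tgt g)) = g
  inv_mul : ∀ g, mul (inv g) g (src_inv g) = unit (src g)
  mul_inv : ∀ g, mul g (inv g) (tgt_inv g).symm = unit (tgt g)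
  smooth_src : ContMDiff Arr.I Obj.I ∞ src
  smooth_tgt : ContMDiff Arr.I Obj.I ∞ tgt
  smooth_unit : ContMDiff Obj.I Arr.I ∞ unit
  smooth_inv : ContMDiff Arr.I Arr.I ∞ inv
  smooth_mul : SmoothOnSubset (Arr.I.prod Arr.I) Arr.I {p : Arr × Arr | src p.1 = tgt p.2}
    (fun p => mul p.1.1 p.1.2 p.2)
  submersion_src : IsSmoothSubmersion Arr.I Obj.I src

namespace SmoothGroupoid

variable (G : SmoothGroupoid.{u})

lemma mul_congr {g g' h h' : G.Arr} (hg : g = g') (hh : h = h') (e : G.src g = G.tgt h)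
    (e' : G.src g' = G.tgt h') : G.mul g h e = G.mul g' h' e' := by
  subst hg hh; rfl

lemma unit_mul' {x : G.Obj} {g : G.Arr} (e : G.src (G.unit x) = G.tgt g) :
    G.mul (G.unit x) g e = g := by
  obtain rfl : x = G.tgt g := by rw [← e, G.src_unit]
  exact G.unit_mul g

lemma mul_unit' {x : G.Obj} {g : G.Arr} (e : G.src g = G.tgt (G.unit x)) :
    G.mul g (G.unit x) e = g := by
  obtain rfl : x = G.src g := by rw [e, G.tgt_unit]
  exact G.mul_unit g

/-- Objects joined by an arrow. -/
def orbitSetoid : Setoid G.Obj where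
  r x y := ∃ g : G.Arr, G.src g = x ∧ G.tgt g = y
  iseqv :=
    { refl := fun x => ⟨G.unit x, G.src_unit x, G.tgt_unit x⟩
      symm := by
        rintro x y ⟨g, rfl, rfl⟩
        exact ⟨G.inv g, G.src_inv g, G.tgt_inv g⟩
      trans := by
        rintro x y z ⟨g, rfl, rfl⟩ ⟨h, hs, rfl⟩
        exact ⟨G.mul h g hs, G.src_mul .., G.tgt_mul ..⟩ }

/-- The coarse quotient, with the quotient topology. -/
abbrev Coarse : Type u := Quotient G.orbitSetoid

/-- A groupoid is connected if its coarse quotient is. -/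
def IsConnected : Prop := ConnectedSpace G.Coarse

/-- Étale groupoids. -/
class IsEtale : Prop where
  etale : IsLocalDiffeomorph G.Arr.I G.Obj.I ∞ G.src

/-- Orbifold groupoids: smooth proper étale groupoids. -/
class IsOrbifold : Prop extends G.IsEtale where
  proper : IsProperMap (fun g : G.Arr => (G.src g, G.tgt g))

/-! ### Stabilizers -/

/-- The space of all stabilizer arrows. -/
def stabilizerSpace : Set G.Arr := {g | G.src g = G.tgt g}

/-- The stabilizer of an object. -/
@[ext]
structure Stab (x : G.Obj) where
  arr : G.Arr
  src_eq : G.src arr = x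
  tgt_eq : G.tgt arr = x

instance (x : G.Obj) : Group (G.Stab x) where
  mul a b := ⟨G.mul a.arr b.arr (a.src_eq.trans b.tgt_eq.symm),
    (G.src_mul ..).trans b.src_eq, (G.tgt_mul ..).trans a.tgt_eq⟩
  one := ⟨G.unit x, G.src_unit x, G.tgt_unit x⟩
  inv a := ⟨G.inv a.arr, (G.src_inv _).trans a.tgt_eq, (G.tgt_inv _).trans a.src_eq⟩
  mul_assoc a b c := Stab.ext (G.mul_assoc a.arr b.arr c.arr _ _).symm
  one_mul a := Stab.ext (G.unit_mul' _)
  mul_one a := Stab.ext (G.mul_unit' _)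
  inv_mul_cancel a := Stab.ext ((G.inv_mul a.arr).trans (congrArg G.unit a.src_eq))

lemma continuousAt_mul {X : Type*} [TopologicalSpace X] {x : X} {a b : X → G.Arr}
    (ha : ContinuousAt a x) (hb : ContinuousAt b x) (h : ∀ y, G.src (a y) = G.tgt (b y)) :
    ContinuousAt (fun y => G.mul (a y) (b y) (h y)) x := by
  obtain ⟨U, hU, hxU, F, hF, hFe⟩ := G.smooth_mul ⟨(a x, b x), h x⟩
  have h1 : ContinuousAt F (a x, b x) := (hF.continuousOn).continuousAt (hU.mem_nhds hxU)
  have h2 : ContinuousAt (fun y => (a y, b y)) x := ha.prodMk hb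
  have h3 : ContinuousAt (fun y => F (a y, b y)) x :=
    ContinuousAt.comp (f := fun y => (a y, b y)) (g := F) h1 h2
  refine h3.congr ?_
  filter_upwards [h2.preimage_mem_nhds (hU.mem_nhds hxU)] with y hy
  exact hFe ⟨(a y, b y), h y⟩ hy

/-- The stabilizers of an orbifold groupoid are finite. -/
instance [hG : G.IsOrbifold] (x : G.Obj) : Finite (G.Stab x) := by
  have hK : IsCompact {g : G.Arr | G.src g = x ∧ G.tgt g = x} := by
    have := hG.proper.isCompact_preimage (isCompact_singleton (x := (x, x)))
    convert this using 1
    ext g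
    simp
  have hD : DiscreteTopology {g : G.Arr | G.src g = x ∧ G.tgt g = x} := by
    rw [discreteTopology_subtype_iff']
    rintro g ⟨hg, hg'⟩
    have hl := hG.etale g
    refine ⟨hl.localInverse.target, hl.localInverse.open_target, ?_⟩
    ext k
    constructor
    · rintro ⟨hk, hk1, hk2⟩
      have e1 := hl.localInverse_left_inv hk
      have e2 := hl.localInverse_left_inv hl.localInverse_mem_target
      rw [hk1] at e1
      rw [hg] at e2
      exact e1.symm.trans e2
    · rintro rfl
      exact ⟨hl.localInverse_mem_target, hg, hg'⟩
  have := isCompact_iff_compactSpace.1 hK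
  have : Finite {g : G.Arr | G.src g = x ∧ G.tgt g = x} := finite_of_compact_of_discrete
  exact Finite.of_injective
    (fun a : G.Stab x => (⟨a.arr, a.src_eq, a.tgt_eq⟩ : {g : G.Arr | G.src g = x ∧ G.tgt g = x}))
    fun a b h => Stab.ext (congrArg Subtype.val h)

variable [hG : G.IsEtale]

/-- The germ at `src g` of the local diffeomorphism of the space of objects induced by `g`:
a local inverse of `src` through `g`, followed by `tgt`. -/
def inducedGerm (g : G.Arr) : (𝓝 (G.src g)).Germ G.Obj :=
  ((fun y => G.tgt ((hG.etale g).localInverse y) : G.Obj → G.Obj) : (𝓝 (G.src g)).Germ G.Obj)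

/-- The space of ineffective stabilizers: the stabilizer arrows whose germ is trivial. -/
def ineffectiveSpace : Set G.Arr :=
  {g | g ∈ G.stabilizerSpace ∧ G.inducedGerm g = ((id : G.Obj → G.Obj) : (𝓝 (G.src g)).Germ G.Obj)}

/-- Purely ineffective groupoids. -/
def IsPurelyIneffective : Prop := G.ineffectiveSpace = G.stabilizerSpace

lemma mem_ineffectiveSpace_iff (g : G.Arr) :
    g ∈ G.ineffectiveSpace ↔ ∀ᶠ h in 𝓝 g, G.src h = G.tgt h := by
  have hl := hG.etale g
  have hsg : Filter.Tendsto G.src (𝓝 g) (𝓝 (G.src g)) :=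
    G.smooth_src.continuous.continuousAt
  have hcont : Filter.Tendsto hl.localInverse (𝓝 (G.src g)) (𝓝 g) := by
    have h1 : ContinuousAt hl.localInverse (G.src g) := hl.localInverse_contMDiffAt.continuousAt
    have h2 : hl.localInverse (G.src g) = g := hl.localInverse_left_inv hl.localInverse_mem_target
    unfold ContinuousAt at h1
    rwa [h2] at h1
  have hleft : ∀ᶠ h in 𝓝 g, hl.localInverse (G.src h) = h := hl.localInverse_eventuallyEq_left
  have hright : ∀ᶠ y in 𝓝 (G.src g), G.src (hl.localInverse y) = y :=
    hl.localInverse_eventuallyEq_right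
  have key : G.inducedGerm g = ((id : G.Obj → G.Obj) : (𝓝 (G.src g)).Germ G.Obj) ↔
      ∀ᶠ y in 𝓝 (G.src g), G.tgt (hl.localInverse y) = y := Filter.Germ.coe_eq
  constructor
  · rintro ⟨-, h⟩
    filter_upwards [hleft, hsg.eventually (key.1 h)] with k hk hk'
    rw [hk] at hk'
    exact hk'.symm
  · intro h
    refine ⟨h.self_of_nhds, key.2 ?_⟩
    filter_upwards [hright, hcont.eventually h] with y hy hy'
    rw [← hy', hy]

lemma unit_mem_ineffectiveSpace (x : G.Obj) : G.unit x ∈ G.ineffectiveSpace := by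
  rw [mem_ineffectiveSpace_iff]
  have hl := hG.etale (G.unit x)
  have h2 : ∀ᶠ h in 𝓝 (G.unit x), hl.localInverse (G.src h) = h :=
    hl.localInverse_eventuallyEq_left
  have hc : Filter.Tendsto (fun h => G.unit (G.src h)) (𝓝 (G.unit x)) (𝓝 (G.unit x)) := by
    have := (G.smooth_unit.continuous.comp G.smooth_src.continuous).continuousAt
      (x := G.unit x)
    unfold ContinuousAt at this
    simpa [G.src_unit, Function.comp_def] using this
  filter_upwards [h2, hc.eventually h2] with h hh hh'
  rw [G.src_unit, hh] at hh'
  conv_rhs => rw [hh', G.tgt_unit]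

/-- The group of ineffective stabilizers at `x`. -/
def ineffStab (x : G.Obj) : Subgroup (G.Stab x) where
  carrier := {a | a.arr ∈ G.ineffectiveSpace}
  one_mem' := G.unit_mem_ineffectiveSpace x
  inv_mem' := by
    intro a ha
    have h1 : ∀ᶠ k in 𝓝 a.arr, G.src k = G.tgt k := (G.mem_ineffectiveSpace_iff _).1 ha
    refine (G.mem_ineffectiveSpace_iff _).2 ?_
    have h2 : G.inv (a⁻¹).arr = a.arr := congrArg Stab.arr (inv_inv a)
    have hc : Filter.Tendsto G.inv (𝓝 (a⁻¹).arr) (𝓝 a.arr) := by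
      have := G.smooth_inv.continuous.continuousAt (x := (a⁻¹).arr)
      unfold ContinuousAt at this
      rwa [h2] at this
    filter_upwards [hc.eventually h1] with k hk
    rw [G.src_inv, G.tgt_inv] at hk
    exact hk.symm
  mul_mem' := by
    classical
    intro a b ha hb
    have ha' : ∀ᶠ k in 𝓝 a.arr, G.src k = G.tgt k := (G.mem_ineffectiveSpace_iff _).1 ha
    have hb' : ∀ᶠ k in 𝓝 b.arr, G.src k = G.tgt k := (G.mem_ineffectiveSpace_iff _).1 hb
    refine (G.mem_ineffectiveSpace_iff _).2 ?_
    have hl := hG.etale b.arr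
    have hxb : G.src b.arr = x := b.src_eq
    have hsab : G.src (a * b).arr = x := (a * b).src_eq
    have hσx : hl.localInverse x = b.arr := by
      have h0 := hl.localInverse_left_inv hl.localInverse_mem_target
      rwa [hxb] at h0
    have hcont : ContinuousAt hl.localInverse x := by
      have h0 := hl.localInverse_contMDiffAt.continuousAt
      rwa [hxb] at h0
    have hright : ∀ᶠ y in 𝓝 x, G.src (hl.localInverse y) = y := by
      have h0 : ∀ᶠ y in 𝓝 (G.src b.arr), G.src (hl.localInverse y) = y :=
        hl.localInverse_eventuallyEq_right
      rwa [hxb] at h0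
    have hsrc : Filter.Tendsto G.src (𝓝 (a * b).arr) (𝓝 x) := by
      have := G.smooth_src.continuous.continuousAt (x := (a * b).arr)
      unfold ContinuousAt at this
      rwa [hsab] at this
    have htσ : ∀ᶠ y in 𝓝 x, G.src (hl.localInverse y) = G.tgt (hl.localInverse y) := by
      unfold ContinuousAt at hcont
      rw [hσx] at hcont
      exact hcont.eventually hb'
    let r : G.Arr → G.Arr := fun k =>
      if G.src (hl.localInverse (G.src k)) = G.src k then G.inv (hl.localInverse (G.src k))
      else G.inv k
    have hr : ∀ k, G.src k = G.tgt (r k) := by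
      intro k
      by_cases h : G.src (hl.localInverse (G.src k)) = G.src k
      · simp only [r, if_pos h, G.tgt_inv, h]
      · simp only [r, if_neg h, G.tgt_inv]
    have hre : ∀ᶠ k in 𝓝 (a * b).arr, r k = G.inv (hl.localInverse (G.src k)) := by
      filter_upwards [hsrc.eventually hright] with k hk
      simp only [r, if_pos hk]
    have hrc : ContinuousAt r (a * b).arr := by
      have h1 : ContinuousAt (fun k => G.inv (hl.localInverse (G.src k))) (a * b).arr := by
        refine G.smooth_inv.continuous.continuousAt.comp (f := fun k => hl.localInverse (G.src k)) ?_
        refine ContinuousAt.comp (f := G.src) (g := hl.localInverse) ?_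
          G.smooth_src.continuous.continuousAt
        rwa [hsab]
      exact h1.congr (hre.mono fun _ h => h.symm)
    have hm := G.continuousAt_mul (continuousAt_id (x := (a * b).arr)) hrc hr
    have hval : G.mul (id (a * b).arr) (r (a * b).arr) (hr _) = a.arr := by
      have h1 : r (a * b).arr = (b⁻¹).arr := by
        rw [hre.self_of_nhds, hsab, hσx]; rfl
      refine (G.mul_congr rfl h1 _ ((a * b).src_eq.trans (b⁻¹).tgt_eq.symm)).trans ?_
      exact congrArg Stab.arr (mul_inv_cancel_right a b)
    unfold ContinuousAt at hm
    simp only [hval] at hm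
    filter_upwards [hm.eventually ha', hre, hsrc.eventually hright, hsrc.eventually htσ]
      with k h1 h2 h3 h4
    rw [G.src_mul, G.tgt_mul, h2, G.src_inv, ← h4, h3] at h1
    exact h1

end SmoothGroupoid

/-! ### Lie group actions on groupoids and semidirect products -/

/-- A (strict, smooth) right action of the group `K` on the smooth groupoid `G`. -/
structure SmoothGroupoid.RightAction (G : SmoothGroupoid.{u})
    {E : Type*} [NormedAddCommGroup E] [NormedSpace ℝ E] {H : Type*} [TopologicalSpace H]
    (I : ModelWithCorners ℝ E H) (K : Type*) [TopologicalSpace K] [ChartedSpace H K] [Group K] where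
  obj : G.Obj → K → G.Obj
  arr : G.Arr → K → G.Arr
  obj_one : ∀ x, obj x 1 = x
  obj_mul : ∀ x k l, obj x (k * l) = obj (obj x k) l
  arr_one : ∀ g, arr g 1 = g
  arr_mul : ∀ g k l, arr g (k * l) = arr (arr g k) l
  smooth_obj : ContMDiff (G.Obj.I.prod I) G.Obj.I ∞ (fun p : G.Obj × K => obj p.1 p.2)
  smooth_arr : ContMDiff (G.Arr.I.prod I) G.Arr.I ∞ (fun p : G.Arr × K => arr p.1 p.2)
  unit_act : ∀ x k, arr (G.unit x) k = G.unit (obj x k)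
  src_act : ∀ g k, G.src (arr g k) = obj (G.src g) k
  tgt_act : ∀ g k, G.tgt (arr g k) = obj (G.tgt g) k
  mul_act : ∀ g h (e : G.src g = G.tgt h) k, arr (G.mul g h e) k =
    G.mul (arr g k) (arr h k)
      ((src_act g k).trans ((congrArg (fun x => obj x k) e).trans (tgt_act h k).symm))

namespace SmoothGroupoid

section Actions

variable {G : SmoothGroupoid.{u}}
  {EK : Type*} [NormedAddCommGroup EK] [NormedSpace ℝ EK] {HK : Type*} [TopologicalSpace HK]
  {IK : ModelWithCorners ℝ EK HK}
  {K : Type*} [TopologicalSpace K] [ChartedSpace HK K] [Group K]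
  {EL : Type} [NormedAddCommGroup EL] [NormedSpace ℝ EL] [FiniteDimensional ℝ EL]
  {HL : Type} [TopologicalSpace HL]
  {IL : ModelWithCorners ℝ EL HL} [IL.Boundaryless]
  {L : Type u} [TopologicalSpace L] [ChartedSpace HL L] [Group L] [LieGroup IL ∞ L]
  [T2Space L] [SecondCountableTopology L]

/-- Inverses are preserved by an action. -/
lemma RightAction.inv_act (α : G.RightAction IK K) (g : G.Arr) (k : K) :
    α.arr (G.inv g) k = G.inv (α.arr g k) := by
  have e1 : G.src (α.arr (G.inv g) k) = G.tgt (α.arr g k) := by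
    rw [α.src_act, α.tgt_act, G.src_inv]
  have e2 : G.src (α.arr g k) = G.tgt (G.inv (α.arr g k)) := (G.tgt_inv _).symm
  have h1 : G.mul (α.arr (G.inv g) k) (α.arr g k) e1 = G.unit (α.obj (G.src g) k) := by
    rw [← α.mul_act _ _ (G.src_inv g), G.inv_mul, α.unit_act]
  have h2 := G.mul_assoc (α.arr (G.inv g) k) (α.arr g k) (G.inv (α.arr g k)) e1 e2
  rw [G.mul_congr rfl (G.mul_inv (α.arr g k)) _ (by rw [G.tgt_unit, e1]), G.mul_unit',
    G.mul_congr h1 rfl _ (by rw [G.src_unit, G.tgt_inv, α.src_act]), G.unit_mul'] at h2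
  exact h2

/-- The action of the first factor of a product group acting on `G`. -/
def RightAction.fst (β : G.RightAction (IK.prod IL) (K × L)) : G.RightAction IK K where
  obj x k := β.obj x (k, 1)
  arr g k := β.arr g (k, 1)
  obj_one := β.obj_one
  obj_mul x k l := by rw [← β.obj_mul]; simp
  arr_one := β.arr_one
  arr_mul x k l := by rw [← β.arr_mul]; simp
  smooth_obj := β.smooth_obj.comp
    (contMDiff_fst.prodMk (contMDiff_snd.prodMk contMDiff_const))
  smooth_arr := β.smooth_arr.comp
    (contMDiff_fst.prodMk (contMDiff_snd.prodMk contMDiff_const))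
  unit_act x k := β.unit_act x _
  src_act g k := β.src_act g _
  tgt_act g k := β.tgt_act g _
  mul_act g h e k := β.mul_act g h e _

/-- The action of the second factor of a product group acting on `G`. -/
def RightAction.snd (β : G.RightAction (IK.prod IL) (K × L)) : G.RightAction IL L where
  obj x l := β.obj x (1, l)
  arr g l := β.arr g (1, l)
  obj_one := β.obj_one
  obj_mul x k l := by rw [← β.obj_mul]; simp
  arr_one := β.arr_one
  arr_mul x k l := by rw [← β.arr_mul]; simp
  smooth_obj := β.smooth_obj.comp
    (contMDiff_fst.prodMk (contMDiff_const.prodMk contMDiff_snd))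
  smooth_arr := β.smooth_arr.comp
    (contMDiff_fst.prodMk (contMDiff_const.prodMk contMDiff_snd))
  unit_act x k := β.unit_act x _
  src_act g k := β.src_act g _
  tgt_act g k := β.tgt_act g _
  mul_act g h e k := β.mul_act g h e _

lemma RightAction.semidirect_aux (α : G.RightAction IK K) {g g' : G.Arr} {l : K}
    (e : α.obj (G.src g) l = G.tgt g') : G.src g = G.tgt (α.arr g' l⁻¹) := by
  rw [α.tgt_act, ← e, ← α.obj_mul, mul_inv_cancel, α.obj_one]

lemma RightAction.smooth_obj_const (α : G.RightAction IK K) (l : K) :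
    ContMDiff G.Obj.I G.Obj.I ∞ (fun x => α.obj x l) :=
  α.smooth_obj.comp (contMDiff_id.prodMk contMDiff_const)

lemma RightAction.surjective_mfderiv (α : G.RightAction IK K) (p : G.Arr × K) :
    Function.Surjective (mfderiv (G.Arr.I.prod IK) G.Obj.I
      (fun p : G.Arr × K => α.obj (G.src p.1) p.2) p) := by
  obtain ⟨g, l⟩ := p
  have hsm : ContMDiff (G.Arr.I.prod IK) G.Obj.I ∞
      (fun p : G.Arr × K => α.obj (G.src p.1) p.2) :=
    α.smooth_obj.comp ((G.smooth_src.comp contMDiff_fst).prodMk contMDiff_snd)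
  have hin : ContMDiff G.Arr.I (G.Arr.I.prod IK) ∞ (fun g' : G.Arr => (g', l)) :=
    contMDiff_id.prodMk contMDiff_const
  have h1 := mfderiv_comp g (hsm.mdifferentiable (by simp) (g, l))
    (hin.mdifferentiable (by simp) g)
  have h2 := mfderiv_comp g ((α.smooth_obj_const l).mdifferentiable (by simp) (G.src g))
    (G.smooth_src.mdifferentiable (by simp) g)
  have h3 : Function.Surjective
      (mfderiv G.Obj.I G.Obj.I (fun x => α.obj x l) (G.src g)) := by
    have hx : α.obj (α.obj (G.src g) l) l⁻¹ = G.src g := by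
      rw [← α.obj_mul, mul_inv_cancel, α.obj_one]
    have h4 := mfderiv_comp (I := G.Obj.I) (I' := G.Obj.I) (I'' := G.Obj.I)
      (g := fun x => α.obj x l) (f := fun x => α.obj x l⁻¹) (α.obj (G.src g) l)
      ((α.smooth_obj_const l).mdifferentiable (by simp) _)
      ((α.smooth_obj_const l⁻¹).mdifferentiable (by simp) _)
    have h5 : (fun x => α.obj x l) ∘ (fun x => α.obj x l⁻¹) = id := by
      funext x
      simp only [Function.comp, ← α.obj_mul, inv_mul_cancel, α.obj_one, id]
    rw [h5, mfderiv_id] at h4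
    rw [hx] at h4
    intro v
    refine ⟨mfderiv G.Obj.I G.Obj.I (fun x => α.obj x l⁻¹) (α.obj (G.src g) l) v, ?_⟩
    exact (congrArg (fun T => T v) h4).symm
  have h6 : (fun p : G.Arr × K => α.obj (G.src p.1) p.2) ∘ (fun g' : G.Arr => (g', l)) =
      (fun x => α.obj x l) ∘ G.src := rfl
  rw [h6, h2] at h1
  intro v
  obtain ⟨w, hw⟩ := h3 v
  obtain ⟨z, hz⟩ := G.submersion_src.2 g w
  refine ⟨mfderiv G.Arr.I (G.Arr.I.prod IK) (fun g' : G.Arr => (g', l)) g z, ?_⟩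
  have h7 := congrArg (fun T => T z) h1
  refine h7.symm.trans ?_
  rw [← hw, ← hz]
  rfl

/-- The semidirect product `G ⋊ L`. -/
def semidirect (α : G.RightAction IL L) : SmoothGroupoid.{u} where
  Obj := G.Obj
  Arr := G.Arr.prod (Mfd.ofLie IL L)
  src p := α.obj (G.src p.1) p.2
  tgt p := G.tgt p.1
  unit x := (G.unit x, 1)
  inv p := (α.arr (G.inv p.1) p.2, p.2⁻¹)
  mul p q e := (G.mul p.1 (α.arr q.1 p.2⁻¹) (α.semidirect_aux e), p.2 * q.2)
  src_unit x := by rw [α.obj_one, G.src_unit]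
  tgt_unit x := G.tgt_unit x
  src_inv p := by
    rw [α.src_act, ← α.obj_mul, mul_inv_cancel, α.obj_one, G.src_inv]
  tgt_inv p := by rw [α.tgt_act, G.tgt_inv]
  src_mul p q e := by
    rw [G.src_mul, α.src_act, ← α.obj_mul]
    congr 1
    group
  tgt_mul p q e := G.tgt_mul _ _ _
  mul_assoc p q r e e' := by
    refine Prod.ext ?_ (_root_.mul_assoc _ _ _).symm
    have h1 := α.mul_act q.1 (α.arr r.1 q.2⁻¹) (α.semidirect_aux e') p.2⁻¹
    have h2 : α.arr (α.arr r.1 q.2⁻¹) p.2⁻¹ = α.arr r.1 (p.2 * q.2)⁻¹ := by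
      rw [← α.arr_mul, mul_inv_rev]
    refine (G.mul_congr rfl h1 _ ?_).trans ?_
    · rw [← h1]; exact α.semidirect_aux (e.trans (G.tgt_mul _ _ _).symm)
    · rw [G.mul_assoc _ _ _ (α.semidirect_aux e)]
      exact G.mul_congr rfl h2 _ _
  mul_unit p := by
    refine Prod.ext ?_ (mul_one _)
    have h1 : α.arr (G.unit (α.obj (G.src p.1) p.2)) p.2⁻¹ = G.unit (G.src p.1) := by
      rw [α.unit_act, ← α.obj_mul, mul_inv_cancel, α.obj_one]
    exact (G.mul_congr rfl h1 _ (G.tgt_unit _).symm).trans (G.mul_unit _)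
  unit_mul p := by
    refine Prod.ext ?_ (one_mul _)
    have h1 : α.arr p.1 (1 : L)⁻¹ = p.1 := by rw [inv_one, α.arr_one]
    exact (G.mul_congr rfl h1 _ (G.src_unit _)).trans (G.unit_mul _)
  inv_mul p := by
    refine Prod.ext ?_ (inv_mul_cancel _)
    have h1 : α.arr p.1 (p.2⁻¹)⁻¹ = α.arr p.1 p.2 := by rw [inv_inv]
    refine (G.mul_congr rfl h1 _ ?_).trans ?_
    · rw [α.src_act, α.tgt_act, G.src_inv]
    · rw [← α.mul_act _ _ (G.src_inv _), G.inv_mul, α.unit_act]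
  mul_inv p := by
    refine Prod.ext ?_ (mul_inv_cancel _)
    have h1 : α.arr (α.arr (G.inv p.1) p.2) p.2⁻¹ = G.inv p.1 := by
      rw [← α.arr_mul, mul_inv_cancel, α.arr_one]
    exact (G.mul_congr rfl h1 _ (G.tgt_inv _).symm).trans (G.mul_inv _)
  smooth_src := α.smooth_obj.comp
    ((G.smooth_src.comp contMDiff_fst).prodMk contMDiff_snd)
  smooth_tgt := G.smooth_tgt.comp contMDiff_fst
  smooth_unit := G.smooth_unit.prodMk contMDiff_const
  smooth_inv := (α.smooth_arr.comp
    ((G.smooth_inv.comp contMDiff_fst).prodMk contMDiff_snd)).prodMk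
      ((contMDiff_inv IL ∞).comp contMDiff_snd)
  smooth_mul := by
    rintro ⟨⟨p, q⟩, e⟩
    obtain ⟨U, hU, hpU, F, hF, hFe⟩ :=
      G.smooth_mul ⟨(p.1, α.arr q.1 p.2⁻¹), α.semidirect_aux e⟩
    let Ψ : (G.Arr × L) × (G.Arr × L) → G.Arr × G.Arr := fun z => (z.1.1, α.arr z.2.1 z.1.2⁻¹)
    have hΨ : ContMDiff ((G.Arr.I.prod IL).prod (G.Arr.I.prod IL)) (G.Arr.I.prod G.Arr.I) ∞ Ψ :=
      (contMDiff_fst.comp contMDiff_fst).prodMk (α.smooth_arr.comp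
        ((contMDiff_fst.comp contMDiff_snd).prodMk
          ((contMDiff_inv IL ∞).comp (contMDiff_snd.comp contMDiff_fst))))
    have hm : ContMDiff ((G.Arr.I.prod IL).prod (G.Arr.I.prod IL)) IL ∞
        (fun z : (G.Arr × L) × (G.Arr × L) => z.1.2 * z.2.2) :=
      (contMDiff_snd.comp contMDiff_fst).mul (contMDiff_snd.comp contMDiff_snd)
    refine ⟨Ψ ⁻¹' U, hU.preimage hΨ.continuous, hpU, fun z => (F (Ψ z), z.1.2 * z.2.2), ?_, ?_⟩
    · exact (hF.comp hΨ.contMDiffOn (fun z hz => hz)).prodMk hm.contMDiffOn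
    · rintro ⟨⟨p', q'⟩, e'⟩ hz
      exact Prod.ext (hFe ⟨Ψ (p', q'), α.semidirect_aux e'⟩ hz) rfl
  submersion_src := ⟨α.smooth_obj.comp
    ((G.smooth_src.comp contMDiff_fst).prodMk contMDiff_snd), α.surjective_mfderiv⟩

/-- If `K × L` acts on `G`, then `K` acts on `G ⋊ L` by `(g, l) · k = (g · k, l)`. -/
def RightAction.onSemidirect (β : G.RightAction (IK.prod IL) (K × L)) :
    (semidirect β.snd).RightAction IK K where
  obj x k := β.obj x (k, 1)
  arr p k := (β.arr p.1 (k, 1), p.2)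
  obj_one := β.obj_one
  obj_mul := β.fst.obj_mul
  arr_one p := Prod.ext (β.arr_one p.1) rfl
  arr_mul p k l := Prod.ext (β.fst.arr_mul p.1 k l) rfl
  smooth_obj := β.fst.smooth_obj
  smooth_arr := (β.fst.smooth_arr.comp
    ((contMDiff_fst.comp contMDiff_fst).prodMk contMDiff_snd)).prodMk
      (contMDiff_snd.comp contMDiff_fst)
  unit_act x k := Prod.ext (β.unit_act x _) rfl
  src_act p k := by
    change β.obj (G.src (β.arr p.1 (k, 1))) (1, p.2) = β.obj (β.obj (G.src p.1) (1, p.2)) (k, 1)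
    rw [β.src_act, ← β.obj_mul, ← β.obj_mul]
    simp
  tgt_act p k := β.tgt_act p.1 _
  mul_act p q e k := by
    refine Prod.ext ?_ rfl
    have h1 : β.arr (β.arr q.1 (1, p.2⁻¹)) (k, 1) = β.arr (β.arr q.1 (k, 1)) (1, p.2⁻¹) := by
      rw [← β.arr_mul, ← β.arr_mul]
      simp
    exact (β.mul_act p.1 _ (β.snd.semidirect_aux e) (k, 1)).trans (G.mul_congr rfl h1 _ _)

end Actions

/-! ### Hilsum-Skandalis equivalences -/

/-- A right action of the groupoid `G` on the manifold `X`. -/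
structure RightSpace (G : SmoothGroupoid.{u}) (X : Mfd.{u}) where
  base : X → G.Obj
  act : (x : X) → (g : G.Arr) → base x = G.tgt g → X
  smooth_base : ContMDiff X.I G.Obj.I ∞ base
  smooth_act : SmoothOnSubset (X.I.prod G.Arr.I) X.I {p : X × G.Arr | base p.1 = G.tgt p.2}
    (fun p => act p.1.1 p.1.2 p.2)
  base_act : ∀ x g e, base (act x g e) = G.src g
  act_unit : ∀ x, act x (G.unit (base x)) (G.tgt_unit _).symm = x
  act_act : ∀ x g h (e : base x = G.tgt g) (e' : G.src g = G.tgt h),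
    act (act x g e) h ((base_act x g e).trans e') =
      act x (G.mul g h e') (e.trans (G.tgt_mul g h e').symm)

/-- A left action of the groupoid `G` on the manifold `X`. -/
structure LeftSpace (G : SmoothGroupoid.{u}) (X : Mfd.{u}) where
  base : X → G.Obj
  act : (g : G.Arr) → (x : X) → G.src g = base x → X
  smooth_base : ContMDiff X.I G.Obj.I ∞ base
  smooth_act : SmoothOnSubset (G.Arr.I.prod X.I) X.I {p : G.Arr × X | G.src p.1 = base p.2}
    (fun p => act p.1.1 p.1.2 p.2)
  base_act : ∀ g x e, base (act g x e) = G.tgt g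
  unit_act : ∀ x, act (G.unit (base x)) x (G.src_unit _) = x
  act_act : ∀ g h x (e : G.src g = G.tgt h) (e' : G.src h = base x),
    act g (act h x e') (e.trans (base_act h x e').symm) =
      act (G.mul g h e) x ((G.src_mul g h e).trans e')

/-- `p : X → B` is a principal right `G`-bundle: it is an invariant surjective submersion and
`(x, g) ↦ (x, x g)` is a diffeomorphism from `X ×_{G₀} G₁` onto `X ×_B X`. -/
def RightSpace.IsPrincipal {G : SmoothGroupoid.{u}} {X : Mfd.{u}} (a : G.RightSpace X)
    {B : Mfd.{u}} (p : X → B) : Prop :=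
  Function.Surjective p ∧ IsSmoothSubmersion X.I B.I p ∧
  ∃ hinv : ∀ x g e, p (a.act x g e) = p x,
    IsDiffeoOfSubsets (X.I.prod G.Arr.I) (X.I.prod X.I)
      (A := {q : X × G.Arr | a.base q.1 = G.tgt q.2}) (B := {q : X × X | p q.1 = p q.2})
      (fun q => ⟨(q.1.1, a.act q.1.1 q.1.2 q.2), (hinv _ _ _).symm⟩)

/-- `p : X → B` is a principal left `G`-bundle: it is an invariant surjective submersion and
`(g, x) ↦ (g x, x)` is a diffeomorphism from `G₁ ×_{G₀} X` onto `X ×_B X`. -/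
def LeftSpace.IsPrincipal {G : SmoothGroupoid.{u}} {X : Mfd.{u}} (a : G.LeftSpace X)
    {B : Mfd.{u}} (p : X → B) : Prop :=
  Function.Surjective p ∧ IsSmoothSubmersion X.I B.I p ∧
  ∃ hinv : ∀ g x e, p (a.act g x e) = p x,
    IsDiffeoOfSubsets (G.Arr.I.prod X.I) (X.I.prod X.I)
      (A := {q : G.Arr × X | G.src q.1 = a.base q.2}) (B := {q : X × X | p q.1 = p q.2})
      (fun q => ⟨(a.act q.1.1 q.1.2 q.2, q.1.2), hinv _ _ _⟩)

/-- A Hilsum-Skandalis morphism from `G` to `H`. -/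
structure HSMorphism (G H : SmoothGroupoid.{u}) where
  P : Mfd.{u}
  left : G.LeftSpace P
  right : H.RightSpace P
  src_invariant : ∀ p h e, left.base (right.act p h e) = left.base p
  tgt_invariant : ∀ g p e, right.base (left.act g p e) = right.base p
  act_comm : ∀ g p h (e : G.src g = left.base p) (e' : right.base p = H.tgt h),
    right.act (left.act g p e) h ((tgt_invariant g p e).trans e') =
      left.act g (right.act p h e') (e.trans (src_invariant p h e').symm)
  principal : right.IsPrincipal left.base

/-- A Hilsum-Skandalis morphism is an equivalence if it is principal on both sides. -/
def HSMorphism.IsEquivalence {G H : SmoothGroupoid.{u}} (f : G.HSMorphism H) : Prop :=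
  f.left.IsPrincipal f.right.base

section Equivariance

variable {EK : Type*} [NormedAddCommGroup EK] [NormedSpace ℝ EK] {HK : Type*} [TopologicalSpace HK]
  {IK : ModelWithCorners ℝ EK HK}
  {K : Type*} [TopologicalSpace K] [ChartedSpace HK K] [Group K]

/-- A `K`-equivariant structure on a Hilsum-Skandalis morphism between groupoids with right
`K`-actions: a smooth right action of `K` on the bibundle, compatible with everything. -/
structure HSMorphism.Equivariance {G H : SmoothGroupoid.{u}} (f : G.HSMorphism H)
    (α : G.RightAction IK K) (β : H.RightAction IK K) where
  act : f.P → K → f.P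
  act_one : ∀ p, act p 1 = p
  act_mul : ∀ p k l, act p (k * l) = act (act p k) l
  smooth_act : ContMDiff (f.P.I.prod IK) f.P.I ∞ (fun q : f.P × K => act q.1 q.2)
  left_base : ∀ p k, f.left.base (act p k) = α.obj (f.left.base p) k
  right_base : ∀ p k, f.right.base (act p k) = β.obj (f.right.base p) k
  left_act : ∀ g p (e : G.src g = f.left.base p) k, act (f.left.act g p e) k =
    f.left.act (α.arr g k) (act p k) (by rw [α.src_act, left_base, e])
  right_act : ∀ p h (e : f.right.base p = H.tgt h) k, act (f.right.act p h e) k =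
    f.right.act (act p k) (β.arr h k) (by rw [β.tgt_act, right_base, e])

/-- The groupoids `G` and `H` with right `K`-actions are `K`-equivariantly equivalent. -/
def EquivariantlyEquivalent {G H : SmoothGroupoid.{u}}
    (α : G.RightAction IK K) (β : H.RightAction IK K) : Prop :=
  ∃ f : G.HSMorphism H, f.IsEquivalence ∧ Nonempty (f.Equivariance α β)

/-- A `(G, K)`-equivariant isomorphism of local systems of groups over the objects of `G`, from
the constant one with fibre `A` to that of ineffective stabilizers. Here `K` acts on `G` on the
right through `α` and on the group `A` on the right through `ρ`, and an arrow `g : x → y` acts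
on the right by `(y, a) ↦ (x, a)` and, by conjugation, `h ↦ g⁻¹ h g`. -/
structure StabilizerTrivialization {G : SmoothGroupoid.{u}} [G.IsEtale]
    (α : G.RightAction IK K) (A : Type w) [Group A] (ρ : A → K → A) where
  toFun : G.Obj × Disc A → G.Arr
  src_toFun : ∀ x a, G.src (toFun (x, a)) = x
  tgt_toFun : ∀ x a, G.tgt (toFun (x, a)) = x
  /- a diffeomorphism onto the (open) space of ineffective stabilizers -/
  localDiffeo : IsLocalDiffeomorph (G.Obj.I.prod Disc.model) G.Arr.I ∞ toFun
  injective : Function.Injective toFun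
  range_eq : Set.range toFun = G.ineffectiveSpace
  map_mul : ∀ x (a b : Disc A), toFun (x, a * b) =
    G.mul (toFun (x, a)) (toFun (x, b)) ((src_toFun x a).trans (tgt_toFun x b).symm)
  conj : ∀ (g : G.Arr) a, toFun (G.src g, a) =
    G.mul (G.mul (G.inv g) (toFun (G.tgt g, a)) ((G.src_inv g).trans (tgt_toFun _ a).symm)) g
      ((G.src_mul _ _ _).trans (src_toFun _ a))
  equivariant : ∀ x (a : A) k, α.arr (toFun (x, a)) k = toFun (α.obj x k, ρ a k)

end Equivariance

end SmoothGroupoid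

end

/-! Call an isomorphism φ from T onto the full stabilizer of an object y a T-frame at y. The
groupoid G' is the action groupoid of G on the space of all T-frames, where an arrow g carries φ to
g φ g⁻¹. The group K translates frames, and Aut(T) acts on them by precomposition.

The frame space is étale over the objects. Each arrow of a frame extends locally to a section of the
source map. Pure ineffectiveness keeps these sections inside the stabilizers, uniqueness of local
lifts keeps them multiplicative, the Hausdorff property keeps them distinct, and properness ensures
that they exhaust the nearby stabilizers (`Frame.eventually_isFrame`). So stabilizers are locally
constant up to isomorphism. Their isomorphism type is also constant along arrows, and connectedness
of the coarse quotient then gives every object a T-frame (`Frame.surjective_base`). The manifold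
structures on frames and on arrows between frames are pulled back along étale maps to the objects,
so smoothness of a map into them amounts to continuity plus smoothness of the base point.

An arrow of G fixes the frame φ exactly when it is φ(a) for some a commuting with all of T. Hence
c(φ, a) = φ(a) identifies the stabilizers of G' with Z(T) (`FrameArr.range_ofCenter`,
`frameTrivialization`). Compatibility with conjugation is built into the definition of the action on
frames. Equivariance under λ in Aut(T) is the identity φ(a) = (φ ∘ λ)(λ⁻¹ a).

Two frames at the same object differ by a unique automorphism of T, so dividing by Aut(T) recovers
G. The bibundle P consists of the pairs (p, φ) with φ a frame at the source of p. This is the arrow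
manifold of G' itself, with the source frame as left base and the target of p in G as right base.
The group G acts by (p, φ) · h = (h⁻¹ p, φ), and an arrow g of G' acts by p ↦ p g⁻¹ together with
the target frame of g. Explicit division maps on both sides show that P is biprincipal
(`isPrincipal_frameRightSpace`, `isEquivalence_frameMorphism`), and K acts on it through its action
on G'. -/

noncomputable section

/-! ### Lifting smoothness along local diffeomorphisms -/

section LocalDiffeomorphisms

variable {E₁ E₂ E₃ : Type*} [NormedAddCommGroup E₁] [NormedSpace ℝ E₁]
  [NormedAddCommGroup E₂] [NormedSpace ℝ E₂] [NormedAddCommGroup E₃] [NormedSpace ℝ E₃]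
  {H₁ H₂ H₃ : Type*} [TopologicalSpace H₁] [TopologicalSpace H₂] [TopologicalSpace H₃]
  {I₁ : ModelWithCorners ℝ E₁ H₁} {I₂ : ModelWithCorners ℝ E₂ H₂} {I₃ : ModelWithCorners ℝ E₃ H₃}
  {M N B : Type*} [TopologicalSpace M] [ChartedSpace H₁ M] [TopologicalSpace N]
  [ChartedSpace H₂ N] [TopologicalSpace B] [ChartedSpace H₃ B]

/-- A continuous lift of a smooth map along a local diffeomorphism is smooth. -/
lemma ContMDiffAt.of_isLocalDiffeomorphAt_comp {p : N → B} {f : M → N} {x : M}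
    (hp : IsLocalDiffeomorphAt I₂ I₃ ∞ p (f x)) (hf : ContinuousAt f x)
    (h : ContMDiffAt I₁ I₃ ∞ (fun y => p (f y)) x) : ContMDiffAt I₁ I₂ ∞ f x := by
  have h1 : ContMDiffAt I₁ I₂ ∞ (fun y => hp.localInverse (p (f y))) x :=
    ContMDiffAt.comp x (g := hp.localInverse) (f := fun y => p (f y))
      hp.localInverse_contMDiffAt h
  refine h1.congr_of_eventuallyEq ?_
  filter_upwards [hf.eventually hp.localInverse_eventuallyEq_left] with y hy
  exact hy.symm

lemma ContMDiff.of_isLocalDiffeomorph_comp {p : N → B} {f : M → N}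
    (hp : IsLocalDiffeomorph I₂ I₃ ∞ p) (hf : Continuous f)
    (h : ContMDiff I₁ I₃ ∞ (fun y => p (f y))) : ContMDiff I₁ I₂ ∞ f :=
  fun x => ContMDiffAt.of_isLocalDiffeomorphAt_comp (hp _) hf.continuousAt (h x)

/-- A smooth local homeomorphism with smooth local inverses is a local diffeomorphism. -/
lemma isLocalDiffeomorph_of_isLocalHomeomorph {f : M → N} (hf : IsLocalHomeomorph f)
    (hs : ContMDiff I₁ I₂ ∞ f)
    (hi : ∀ e : OpenPartialHomeomorph M N, f = e → ContMDiffOn I₂ I₁ ∞ e.symm e.target) :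
    IsLocalDiffeomorph I₁ I₂ ∞ f := by
  intro x
  obtain ⟨e, hx, rfl⟩ := hf x
  exact PartialDiffeomorph.isLocalDiffeomorphAt I₁ I₂ ∞
    { toPartialEquiv := e.toPartialEquiv
      open_source := e.open_source
      open_target := e.open_target
      contMDiffOn_toFun := hs.contMDiffOn
      contMDiffOn_invFun := hi e rfl } hx

/-- A continuous lift of a local diffeomorphism along a local diffeomorphism is a local
diffeomorphism. -/
lemma IsLocalDiffeomorph.of_comp {p : N → B} {f : M → N}
    (hp : IsLocalDiffeomorph I₂ I₃ ∞ p) (hf : Continuous f)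
    (h : IsLocalDiffeomorph I₁ I₃ ∞ (fun y => p (f y))) : IsLocalDiffeomorph I₁ I₂ ∞ f := by
  have hfl : IsLocalHomeomorph f :=
    IsLocalHomeomorph.of_comp (g := p) h.isLocalHomeomorph hp.isLocalHomeomorph hf
  refine isLocalDiffeomorph_of_isLocalHomeomorph hfl
    (ContMDiff.of_isLocalDiffeomorph_comp hp hf h.contMDiff) ?_
  rintro e rfl y hy
  refine ContMDiffAt.contMDiffWithinAt ?_
  refine ContMDiffAt.of_isLocalDiffeomorphAt_comp (h _) (e.continuousAt_symm hy) ?_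
  refine (hp.contMDiff y).congr_of_eventuallyEq ?_
  filter_upwards [e.open_target.mem_nhds hy] with z hz
  rw [e.right_inv hz]

lemma IsLocalDiffeomorph.comp {p : N → B} {f : M → N} (hp : IsLocalDiffeomorph I₂ I₃ ∞ p)
    (hf : IsLocalDiffeomorph I₁ I₂ ∞ f) : IsLocalDiffeomorph I₁ I₃ ∞ (fun x => p (f x)) :=
  fun x => IsLocalDiffeomorphAt.comp I₃ B (hf x) (hp (f x))

lemma IsLocalDiffeomorph.isSmoothSubmersion {f : M → N} (h : IsLocalDiffeomorph I₁ I₂ ∞ f) :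
    IsSmoothSubmersion I₁ I₂ f := by
  refine ⟨h.contMDiff, fun x => ?_⟩
  rw [← h.mfderivToContinuousLinearEquiv_coe (by simp) x]
  exact (h.mfderivToContinuousLinearEquiv (by simp) x).surjective

/-- The projection of the product with a discrete manifold is a local diffeomorphism. -/
lemma isLocalDiffeomorph_fst_disc {A : Type*} :
    IsLocalDiffeomorph (I₁.prod Disc.model) I₁ ∞ (Prod.fst : M × Disc A → M) := by
  rintro ⟨x, a⟩
  refine PartialDiffeomorph.isLocalDiffeomorphAt (I₁.prod Disc.model) I₁ ∞
    { toFun := Prod.fst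
      invFun := fun x => (x, a)
      source := Set.univ ×ˢ {a}
      target := Set.univ
      map_source' := by simp
      map_target' := by simp
      left_inv' := by
        rintro ⟨y, b⟩ ⟨-, rfl⟩
        rfl
      right_inv' := by simp
      open_source := isOpen_univ.prod (isOpen_discrete _)
      open_target := isOpen_univ
      contMDiffOn_toFun := contMDiff_fst.contMDiffOn
      contMDiffOn_invFun := (contMDiff_id.prodMk contMDiff_const).contMDiffOn } ?_
  simp

/-! ### Smooth maps on subsets -/

namespace SmoothOnSubset

variable {A : Set M}

lemma continuous {f : A → N} (hf : SmoothOnSubset I₁ I₂ A f) : Continuous f := by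
  rw [continuous_iff_continuousAt]
  intro x
  obtain ⟨U, hU, hxU, F, hF, hFe⟩ := hf x
  have h1 : ContinuousAt (fun y : A => F y) x :=
    ContinuousAt.comp (g := F) (f := ((↑) : A → M))
      (hF.continuousOn.continuousAt (hU.mem_nhds hxU)) continuous_subtype_val.continuousAt
  refine h1.congr ?_
  filter_upwards [continuous_subtype_val.continuousAt.preimage_mem_nhds (hU.mem_nhds hxU)] with y hy
  exact hFe y hy

lemma of_contMDiff {f : A → N} {F : M → N} (hF : ContMDiff I₁ I₂ ∞ F) (h : ∀ a : A, F a = f a) :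
    SmoothOnSubset I₁ I₂ A f :=
  fun _ => ⟨Set.univ, isOpen_univ, trivial, F, hF.contMDiffOn, fun y _ => h y⟩

/-- A continuous map on a subset is smooth if its composite with a local diffeomorphism extends
to a smooth map. -/
lemma of_isLocalDiffeomorph {p : N → B} (hp : IsLocalDiffeomorph I₂ I₃ ∞ p) {f : A → N}
    (hf : Continuous f) {F : M → B} (hF : ContMDiff I₁ I₃ ∞ F) (h : ∀ a : A, F a = p (f a)) :
    SmoothOnSubset I₁ I₂ A f := by
  intro x
  have hl := hp (f x)
  -- `W` cuts out the points of `A` whose image lies on the sheet of `p` through `f x`. On another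
  -- sheet the local inverse of `p` need not recover `f`.
  obtain ⟨W, hW, hWe⟩ := isOpen_induced_iff.1 (hl.localInverse.open_target.preimage hf)
  refine ⟨W ∩ F ⁻¹' hl.localInverse.source,
    hW.inter (hl.localInverse_open_source.preimage hF.continuous), ⟨?_, ?_⟩,
    fun y => hl.localInverse (F y), ?_, ?_⟩
  · have : x ∈ Subtype.val ⁻¹' W := by rw [hWe]; exact hl.localInverse_mem_target
    exact this
  · rw [Set.mem_preimage, h]; exact hl.localInverse_mem_source
  · exact hl.localInverse_contMDiffOn.comp hF.contMDiffOn (fun y hy => hy.2)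
  · intro y hy
    have : y ∈ Subtype.val ⁻¹' W := hy.1
    rw [hWe] at this
    change hl.localInverse (F y) = f y
    rw [h]
    exact hl.localInverse_left_inv this

lemma prodMk {f : A → N} {g : A → B} (hf : SmoothOnSubset I₁ I₂ A f)
    (hg : SmoothOnSubset I₁ I₃ A g) :
    SmoothOnSubset I₁ (I₂.prod I₃) A (fun a => (f a, g a)) := by
  intro x
  obtain ⟨U, hU, hxU, F, hF, hFe⟩ := hf x
  obtain ⟨V, hV, hxV, F', hF', hFe'⟩ := hg x
  refine ⟨U ∩ V, hU.inter hV, ⟨hxU, hxV⟩, fun y => (F y, F' y),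
    (hF.mono Set.inter_subset_left).prodMk (hF'.mono Set.inter_subset_right), ?_⟩
  intro y hy
  exact Prod.ext (hFe y hy.1) (hFe' y hy.2)

/-- A continuous map to a discrete space is locally constant, so a constant is a smooth local
extension. -/
lemma of_disc {D : Type*} {f : A → Disc D} (hf : Continuous f) :
    SmoothOnSubset I₁ Disc.model A f := by
  intro x
  obtain ⟨W, hW, hWe⟩ := isOpen_induced_iff.1 ((isOpen_discrete {f x}).preimage hf)
  refine ⟨W, hW, ?_, fun _ => f x, contMDiff_const.contMDiffOn, ?_⟩
  · have : x ∈ Subtype.val ⁻¹' W := by rw [hWe]; exact rfl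
    exact this
  · intro y hy
    have : y ∈ Subtype.val ⁻¹' W := hy
    rw [hWe] at this
    exact this.symm

end SmoothOnSubset

end LocalDiffeomorphisms

/-! ### Manifolds étale over a manifold -/

section EtaleManifold

variable {M : Mfd.{u}} {X : Type v} [TopologicalSpace X] {f : X → M}

/-- The charts of a space étale over a manifold. -/
@[reducible]
def etaleChartedSpace (hf : IsLocalHomeomorph f) : ChartedSpace M.H X where
  atlas := {e | ∃ x : X, e = (hf x).choose.trans (chartAt M.H (f x))}
  chartAt x := (hf x).choose.trans (chartAt M.H (f x))
  mem_chart_source x := by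
    have h := (hf x).choose_spec
    refine ⟨h.1, ?_⟩
    change (hf x).choose x ∈ (chartAt M.H (f x)).source
    rw [← h.2]
    exact mem_chart_source _ _
  chart_mem_atlas x := ⟨x, rfl⟩

/-- Every local inverse of `f` is a section of `f`, so `f` cancels in a change of charts of `X`.
What remains is a restriction of a change of charts of `M`. -/
lemma isManifold_etale (hf : IsLocalHomeomorph f) :
    letI := etaleChartedSpace hf
    IsManifold M.I ∞ X := by
  let := etaleChartedSpace hf
  refine isManifold_of_contDiffOn _ _ _ ?_
  rintro _ _ ⟨x, rfl⟩ ⟨y, rfl⟩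
  have hx := (hf x).choose_spec
  have hy := (hf y).choose_spec
  set φ := (hf x).choose
  set ψ := (hf y).choose
  have hM := (contDiffGroupoid ∞ M.I).compatible (chart_mem_atlas M.H (f x))
    (chart_mem_atlas M.H (f y))
  rw [contDiffGroupoid, mem_groupoid_of_pregroupoid] at hM
  have key : ∀ z ∈ (((φ.trans (chartAt M.H (f x))).symm.trans
      (ψ.trans (chartAt M.H (f y)))).source),
      ψ (φ.symm ((chartAt M.H (f x)).symm z)) = (chartAt M.H (f x)).symm z := by
    intro z hz
    have h1 : (chartAt M.H (f x)).symm z ∈ φ.target := by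
      simp only [OpenPartialHomeomorph.trans_source, OpenPartialHomeomorph.symm_source,
        OpenPartialHomeomorph.trans_target] at hz
      exact hz.1.2
    have h2 := φ.right_inv h1
    rw [← hx.2] at h2
    rw [← hy.2]
    exact h2
  refine ContDiffOn.congr (hM.1.mono ?_) ?_
  · rintro w ⟨hw, hw'⟩
    refine ⟨?_, hw'⟩
    have hk := key _ hw
    simp only [OpenPartialHomeomorph.trans_source, OpenPartialHomeomorph.symm_source,
      OpenPartialHomeomorph.trans_target, Set.mem_preimage, Set.mem_inter_iff,
      OpenPartialHomeomorph.coe_trans_symm, Function.comp] at hw hk ⊢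
    rw [hk] at hw
    exact ⟨hw.1.1, hw.2.2⟩
  · rintro w ⟨hw, hw'⟩
    have hk := key _ hw
    simp only [OpenPartialHomeomorph.coe_trans_symm, OpenPartialHomeomorph.coe_trans,
      Function.comp] at hk ⊢
    rw [hk]

variable [T2Space X] [SecondCountableTopology X]

/-- A (Hausdorff, second countable) space étale over a manifold is a manifold. -/
def Mfd.etale (hf : IsLocalHomeomorph f) : Mfd.{v} :=
  letI := etaleChartedSpace hf
  haveI := isManifold_etale hf
  { E := M.E, H := M.H, I := M.I, carrier := X }

variable {E' : Type*} [NormedAddCommGroup E'] [NormedSpace ℝ E'] {H' : Type*} [TopologicalSpace H']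
  {I' : ModelWithCorners ℝ E' H'} {N : Type*} [TopologicalSpace N] [ChartedSpace H' N]

/-- The chart of `X` at `g y` is, as a function on all of `X`, the chart of `M` at `f (g y)`
composed with `f`. The two coordinate expressions therefore coincide, and only continuity of `g` is
extra information. -/
lemma Mfd.contMDiffAt_etale_iff (hf : IsLocalHomeomorph f) {g : N → Mfd.etale hf} {y : N} :
    ContMDiffAt I' (Mfd.etale hf).I ∞ g y ↔
      ContinuousAt g y ∧ ContMDiffAt I' M.I ∞ (fun z => f (g z)) y := by
  rw [contMDiffAt_iff_target, contMDiffAt_iff_target (f := fun z => f (g z))]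
  have h : (extChartAt (Mfd.etale hf).I (g y : Mfd.etale hf) ∘ g) =
      (extChartAt M.I (f (g y)) ∘ fun z => f (g z)) := by
    funext z
    have h2 := (hf (g y)).choose_spec.2
    change M.I (chartAt M.H (f (g y)) ((hf (g y)).choose (g z))) = _
    rw [← h2]
    rfl
  rw [h]
  exact ⟨fun h => ⟨h.1, hf.continuous.continuousAt.comp h.1, h.2⟩, fun h => ⟨h.1, h.2.2⟩⟩

lemma Mfd.isLocalDiffeomorph_etale (hf : IsLocalHomeomorph f) :
    IsLocalDiffeomorph (M := Mfd.etale hf) (Mfd.etale hf).I M.I ∞ f := by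
  refine isLocalDiffeomorph_of_isLocalHomeomorph (M := Mfd.etale hf) hf ?_ ?_
  · intro x
    exact ((Mfd.contMDiffAt_etale_iff (I' := (Mfd.etale hf).I) (N := Mfd.etale hf) hf
      (g := id)).1 contMDiffAt_id).2
  · rintro e he y hy
    refine ContMDiffAt.contMDiffWithinAt ?_
    refine (Mfd.contMDiffAt_etale_iff (I' := M.I) hf).2 ⟨e.continuousAt_symm hy, ?_⟩
    refine contMDiffAt_id.congr_of_eventuallyEq ?_
    filter_upwards [e.open_target.mem_nhds hy] with z hz
    exact (congrFun he _).trans (e.right_inv hz)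

end EtaleManifold

/-! ### Composition of arrows as a total operation -/

namespace SmoothGroupoid

variable (G : SmoothGroupoid.{u})

open Classical in
/-- The composite of two arrows, with junk value `g` if they are not composable. -/
def comp (g h : G.Arr) : G.Arr := if e : G.src g = G.tgt h then G.mul g h e else g

variable {G} {g h k : G.Arr}

lemma mul_eq_comp (e : G.src g = G.tgt h) : G.mul g h e = G.comp g h := by
  rw [comp, dif_pos e]

lemma src_comp (e : G.src g = G.tgt h) : G.src (G.comp g h) = G.src h := by
  rw [← mul_eq_comp e, G.src_mul]

lemma tgt_comp (e : G.src g = G.tgt h) : G.tgt (G.comp g h) = G.tgt g := by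
  rw [← mul_eq_comp e, G.tgt_mul]

lemma comp_assoc (e : G.src g = G.tgt h) (e' : G.src h = G.tgt k) :
    G.comp (G.comp g h) k = G.comp g (G.comp h k) := by
  have := G.mul_assoc g h k e e'
  simp only [mul_eq_comp] at this
  exact this.symm

lemma comp_unit {x : G.Obj} (e : G.src g = x) : G.comp g (G.unit x) = g := by
  rw [← mul_eq_comp (e.trans (G.tgt_unit x).symm), G.mul_unit']

lemma unit_comp {x : G.Obj} (e : x = G.tgt g) : G.comp (G.unit x) g = g := by
  rw [← mul_eq_comp ((G.src_unit x).trans e), G.unit_mul']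

lemma inv_comp (g : G.Arr) : G.comp (G.inv g) g = G.unit (G.src g) := by
  rw [← mul_eq_comp (G.src_inv g), G.inv_mul]

lemma comp_inv (g : G.Arr) : G.comp g (G.inv g) = G.unit (G.tgt g) := by
  rw [← mul_eq_comp (G.tgt_inv g).symm, G.mul_inv]

lemma inv_comp_cancel_left (e : G.src g = G.tgt h) : G.comp (G.inv g) (G.comp g h) = h := by
  rw [← comp_assoc (G.src_inv g) e, inv_comp, unit_comp e]

lemma comp_inv_cancel_left (e : G.tgt g = G.tgt h) : G.comp g (G.comp (G.inv g) h) = h := by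
  rw [← comp_assoc (G.tgt_inv g).symm ((G.src_inv g).trans e), comp_inv, unit_comp e]

lemma comp_inv_cancel_right (e : G.src g = G.tgt h) : G.comp (G.comp g h) (G.inv h) = g := by
  rw [comp_assoc e (G.tgt_inv h).symm, comp_inv, comp_unit e]

lemma inv_comp_cancel_right (e : G.src g = G.src h) : G.comp (G.comp g (G.inv h)) h = g := by
  rw [comp_assoc (e.trans (G.tgt_inv h).symm) (G.src_inv h), inv_comp, comp_unit e]

lemma comp_right_cancel (e : G.src g = G.tgt k) (e' : G.src h = G.tgt k)
    (H : G.comp g k = G.comp h k) : g = h := by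
  rw [← comp_inv_cancel_right e, H, comp_inv_cancel_right e']

lemma inv_inv (g : G.Arr) : G.inv (G.inv g) = g := by
  refine comp_right_cancel (k := G.inv g) (G.src_inv _) (G.tgt_inv _).symm ?_
  rw [inv_comp, comp_inv, G.src_inv]

lemma inv_comp_rev (e : G.src g = G.tgt h) :
    G.inv (G.comp g h) = G.comp (G.inv h) (G.inv g) := by
  have e1 : G.src (G.inv h) = G.tgt (G.inv g) := by rw [G.src_inv, G.tgt_inv, e]
  refine comp_right_cancel (k := G.comp g h) (G.src_inv _)
    (by rw [src_comp e1, G.src_inv, tgt_comp e]) ?_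
  rw [inv_comp, src_comp e, comp_assoc e1 (by rw [G.src_inv, tgt_comp e]),
    inv_comp_cancel_left e, inv_comp]

lemma inv_unit (x : G.Obj) : G.inv (G.unit x) = G.unit x := by
  have := comp_inv (G.unit x)
  rwa [unit_comp (by rw [G.tgt_inv, G.src_unit]), G.tgt_unit] at this

lemma continuousOn_comp :
    ContinuousOn (fun p : G.Arr × G.Arr => G.comp p.1 p.2) {p | G.src p.1 = G.tgt p.2} := by
  rw [continuousOn_iff_continuous_domRestrict]
  refine G.smooth_mul.continuous.congr ?_
  rintro ⟨p, hp⟩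
  exact mul_eq_comp hp

lemma _root_.Continuous.groupoidComp {X : Type*} [TopologicalSpace X] {a b : X → G.Arr}
    (ha : Continuous a) (hb : Continuous b) (h : ∀ x, G.src (a x) = G.tgt (b x)) :
    Continuous (fun x => G.comp (a x) (b x)) :=
  continuousOn_comp.comp_continuous (ha.prodMk hb) h

/-! ### Conjugation -/

variable (G) in
/-- The conjugate `g h g⁻¹`. -/
def conj (g h : G.Arr) : G.Arr := G.comp (G.comp g h) (G.inv g)

section Conj

lemma src_conj (e : G.src g = G.tgt h) (e' : G.src h = G.src g) :
    G.src (G.conj g h) = G.tgt g := by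
  rw [conj, src_comp (by rw [src_comp e, G.tgt_inv, e']), G.src_inv]

lemma tgt_conj (e : G.src g = G.tgt h) (e' : G.src h = G.src g) :
    G.tgt (G.conj g h) = G.tgt g := by
  rw [conj, tgt_comp (by rw [src_comp e, G.tgt_inv, e']), tgt_comp e]

lemma conj_comp_self (e : G.src g = G.tgt h) (e' : G.src h = G.src g) :
    G.comp (G.conj g h) g = G.comp g h :=
  inv_comp_cancel_right (by rw [src_comp e, e'])

/-- Characterizes a conjugate without inverses; the laws of conjugation below then reduce to
associativity. -/
lemma eq_conj_iff (e : G.src g = G.tgt h) (e' : G.src h = G.src g) (hk : G.src k = G.tgt g) :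
    k = G.conj g h ↔ G.comp k g = G.comp g h := by
  constructor
  · rintro rfl
    exact conj_comp_self e e'
  · intro H
    rw [conj, ← H, comp_inv_cancel_right hk]

lemma conj_comp (e : G.src g = G.tgt h) (e' : G.src h = G.src g) (f : G.src g = G.tgt k)
    (f' : G.src k = G.src g) : G.conj g (G.comp h k) = G.comp (G.conj g h) (G.conj g k) := by
  have hk : G.src h = G.tgt k := e'.trans f
  symm
  rw [eq_conj_iff (by rw [tgt_comp hk, e]) (by rw [src_comp hk, f']),
    comp_assoc (by rw [src_conj e e', tgt_conj f f']) (src_conj f f'), conj_comp_self f f',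
    ← comp_assoc (src_conj e e') f, conj_comp_self e e', comp_assoc e hk]
  rw [src_comp (by rw [src_conj e e', tgt_conj f f']), src_conj f f']

lemma conj_conj {g' : G.Arr} (e : G.src g = G.tgt h) (e' : G.src h = G.src g)
    (eg : G.src g' = G.tgt g) : G.conj g' (G.conj g h) = G.conj (G.comp g' g) h := by
  have h1 := tgt_conj e e'
  have h2 := src_conj e e'
  rw [eq_conj_iff (by rw [src_comp eg, e]) (by rw [src_comp eg, e']),
    ← comp_assoc (by rw [src_conj (by rw [eg, h1]) (by rw [h2, eg])]) eg,
    conj_comp_self (by rw [eg, h1]) (by rw [h2, eg]), comp_assoc (by rw [eg, h1]) h2,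
    conj_comp_self e e', comp_assoc eg e]
  rw [src_conj (by rw [eg, h1]) (by rw [h2, eg]), tgt_comp eg]

lemma unit_conj {x : G.Obj} (e : x = G.tgt h) (e' : G.src h = x) : G.conj (G.unit x) h = h := by
  rw [conj, unit_comp e, inv_unit, comp_unit e']

lemma inv_conj_conj (e : G.src g = G.tgt h) (e' : G.src h = G.src g) :
    G.conj (G.inv g) (G.conj g h) = h := by
  rw [conj_conj e e' (G.src_inv g), inv_comp, unit_conj e e']

lemma conj_inv_conj (e : G.tgt g = G.tgt h) (e' : G.src h = G.tgt g) :
    G.conj g (G.conj (G.inv g) h) = h := by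
  rw [conj_conj (by rw [G.src_inv, e]) (by rw [G.src_inv, e']) (by rw [G.tgt_inv]), comp_inv,
    unit_conj e e']

lemma conj_injective (e : G.src g = G.tgt h) (e' : G.src h = G.src g) (f : G.src g = G.tgt k)
    (f' : G.src k = G.src g) (H : G.conj g h = G.conj g k) : h = k := by
  rw [← inv_conj_conj e e', H, inv_conj_conj f f']

lemma _root_.Continuous.groupoidConj {X : Type*} [TopologicalSpace X] {a b : X → G.Arr}
    (ha : Continuous a) (hb : Continuous b) (h : ∀ x, G.src (a x) = G.tgt (b x))
    (h' : ∀ x, G.src (b x) = G.src (a x)) :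
    Continuous (fun x => G.conj (a x) (b x)) := by
  refine (ha.groupoidComp hb h).groupoidComp (G.smooth_inv.continuous.comp ha) fun x => ?_
  rw [src_comp (h x), h']
  exact (G.tgt_inv _).symm

end Conj

section Action

variable {EK : Type*} [NormedAddCommGroup EK] [NormedSpace ℝ EK] {HK : Type*} [TopologicalSpace HK]
  {IK : ModelWithCorners ℝ EK HK}
  {K : Type*} [TopologicalSpace K] [ChartedSpace HK K] [Group K]

lemma RightAction.comp_act (α : G.RightAction IK K) (e : G.src g = G.tgt h) (k : K) :
    α.arr (G.comp g h) k = G.comp (α.arr g k) (α.arr h k) := by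
  rw [← mul_eq_comp e, α.mul_act, mul_eq_comp]

lemma RightAction.conj_act (α : G.RightAction IK K) (e : G.src g = G.tgt h)
    (e' : G.src h = G.src g) (k : K) :
    α.arr (G.conj g h) k = G.conj (α.arr g k) (α.arr h k) := by
  rw [conj, α.comp_act (by rw [src_comp e, G.tgt_inv, e']), α.comp_act e, α.inv_act, conj]

lemma RightAction.arr_arr_inv (α : G.RightAction IK K) (g : G.Arr) (k : K) :
    α.arr (α.arr g k⁻¹) k = g := by
  rw [← α.arr_mul, inv_mul_cancel, α.arr_one]

lemma RightAction.arr_inv_arr (α : G.RightAction IK K) (g : G.Arr) (k : K) :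
    α.arr (α.arr g k) k⁻¹ = g := by
  rw [← α.arr_mul, mul_inv_cancel, α.arr_one]

lemma RightAction.obj_inv_obj (α : G.RightAction IK K) (x : G.Obj) (k : K) :
    α.obj (α.obj x k) k⁻¹ = x := by
  rw [← α.obj_mul, mul_inv_cancel, α.obj_one]

end Action

/-! ### Frames -/

variable (G) in
/-- A `T`-frame: an isomorphism from the group `T` onto the stabilizer of an object. -/
structure IsFrame {T : Type*} [Group T] (φ : T → G.Arr) : Prop where
  src_eq : ∀ a b, G.src (φ a) = G.src (φ b)
  tgt_eq : ∀ a, G.tgt (φ a) = G.src (φ a)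
  map_mul : ∀ a b, φ (a * b) = G.comp (φ a) (φ b)
  injective : Function.Injective φ
  exists_eq : ∀ g, G.src g = G.src (φ 1) → G.tgt g = G.src (φ 1) → ∃ a, φ a = g

variable (G) in
/-- The space of `T`-frames, topologized as a subspace of a finite power of the space of arrows. -/
abbrev Frame (T : Type v) [Group T] : Type (max u v) := {φ : T → G.Arr // G.IsFrame φ}

namespace Frame

variable {T : Type v} [Group T] {S : Type w} [Group S]

/-- The object whose stabilizer is framed. -/
def base (φ : G.Frame T) : G.Obj := G.src (φ.1 1)

lemma src_apply (φ : G.Frame T) (a : T) : G.src (φ.1 a) = φ.base := φ.2.src_eq a 1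

lemma tgt_apply (φ : G.Frame T) (a : T) : G.tgt (φ.1 a) = φ.base :=
  (φ.2.tgt_eq a).trans (φ.src_apply a)

lemma map_mul (φ : G.Frame T) (a b : T) : φ.1 (a * b) = G.comp (φ.1 a) (φ.1 b) :=
  φ.2.map_mul a b

lemma continuous_apply (a : T) : Continuous (fun φ : G.Frame T => φ.1 a) :=
  (_root_.continuous_apply a).comp continuous_subtype_val

lemma continuous_base : Continuous (base : G.Frame T → G.Obj) :=
  G.smooth_src.continuous.comp (continuous_apply 1)

/-- The tautological frame of the stabilizer of an object. -/
def ofStab (x : G.Obj) : G.Frame (G.Stab x) :=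
  ⟨Stab.arr,
    { src_eq := fun a b => a.src_eq.trans b.src_eq.symm
      tgt_eq := fun a => a.tgt_eq.trans a.src_eq.symm
      map_mul := fun a b => mul_eq_comp (a.src_eq.trans b.tgt_eq.symm)
      injective := fun _ _ h => Stab.ext h
      exists_eq := fun g h h' =>
        ⟨⟨g, h.trans (Stab.src_eq _), h'.trans (Stab.src_eq _)⟩, rfl⟩ }⟩

lemma base_ofStab (x : G.Obj) : (ofStab x).base = x := Stab.src_eq (1 : G.Stab x)

/-- Two frames at the same object differ by a group isomorphism. -/
lemma exists_mulEquiv (φ : G.Frame T) (ψ : G.Frame S) (h : φ.base = ψ.base) :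
    ∃ e : S ≃* T, ∀ a, φ.1 (e a) = ψ.1 a := by
  have h1 : ∀ a, ∃ b, φ.1 b = ψ.1 a := fun a =>
    φ.2.exists_eq _ ((ψ.src_apply a).trans h.symm) ((ψ.tgt_apply a).trans h.symm)
  choose e he using h1
  refine ⟨MulEquiv.ofBijective (MonoidHom.mk' e fun a b => ?_) ⟨fun a b hab => ?_, fun a => ?_⟩, he⟩
  · refine φ.2.injective ?_
    rw [he, φ.map_mul, he, he, ψ.map_mul]
  · refine ψ.2.injective ?_
    rw [← he, ← he]
    exact congrArg φ.1 hab
  · obtain ⟨b, hb⟩ := ψ.2.exists_eq (φ.1 a) ((φ.src_apply a).trans h) ((φ.tgt_apply a).trans h)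
    refine ⟨b, φ.2.injective ?_⟩
    exact (he b).trans hb

/-- Precomposition of a frame with a group isomorphism. -/
def precomp (φ : G.Frame T) (e : S ≃* T) : G.Frame S :=
  ⟨fun a => φ.1 (e a),
    { src_eq := fun a b => φ.2.src_eq _ _
      tgt_eq := fun a => φ.2.tgt_eq _
      map_mul := fun a b => by rw [_root_.map_mul, φ.map_mul]
      injective := φ.2.injective.comp e.injective
      exists_eq := fun g h h' => by
        rw [_root_.map_one] at h h'
        obtain ⟨a, ha⟩ := φ.2.exists_eq g h h'
        exact ⟨e.symm a, by rw [e.apply_symm_apply, ha]⟩ }⟩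

lemma base_precomp (φ : G.Frame T) (e : S ≃* T) : (φ.precomp e).base = φ.base :=
  φ.src_apply _

/-- The frame `a ↦ g φ(a) g⁻¹`. -/
def conj (g : G.Arr) (φ : G.Frame T) (h : G.src g = φ.base) : G.Frame T :=
  ⟨fun a => G.conj g (φ.1 a), by
    have e : ∀ a, G.src g = G.tgt (φ.1 a) := fun a => h.trans (φ.tgt_apply a).symm
    have e' : ∀ a, G.src (φ.1 a) = G.src g := fun a => (φ.src_apply a).trans h.symm
    exact
    { src_eq := fun a b => by rw [src_conj (e a) (e' a), src_conj (e b) (e' b)]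
      tgt_eq := fun a => by rw [src_conj (e a) (e' a), tgt_conj (e a) (e' a)]
      map_mul := fun a b => by rw [φ.map_mul, conj_comp (e a) (e' a) (e b) (e' b)]
      injective := fun a b hab => φ.2.injective (conj_injective (e a) (e' a) (e b) (e' b) hab)
      exists_eq := fun k hk hk' => by
        rw [src_conj (e 1) (e' 1)] at hk hk'
        have hs : G.src (G.inv g) = G.tgt k := by rw [G.src_inv, hk']
        have hs' : G.src k = G.src (G.inv g) := by rw [G.src_inv, hk]
        obtain ⟨a, ha⟩ := φ.2.exists_eq (G.conj (G.inv g) k)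
          (by rw [src_conj hs hs', G.tgt_inv, h]; rfl) (by rw [tgt_conj hs hs', G.tgt_inv, h]; rfl)
        exact ⟨a, by rw [ha, conj_inv_conj hk'.symm hk]⟩ }⟩

section Conj

variable (φ : G.Frame T)

lemma base_conj (h : G.src g = φ.base) : (φ.conj g h).base = G.tgt g :=
  src_conj (h.trans (φ.tgt_apply 1).symm) ((φ.src_apply 1).trans h.symm)

lemma conj_unit (h : G.src (G.unit φ.base) = φ.base) : φ.conj (G.unit φ.base) h = φ :=
  Subtype.ext (funext fun a => unit_conj (φ.tgt_apply a).symm (φ.src_apply a))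

lemma conj_conj (h : G.src g = φ.base) {g' : G.Arr} (h' : G.src g' = (φ.conj g h).base)
    (h'' : G.src (G.comp g' g) = φ.base) :
    (φ.conj g h).conj g' h' = φ.conj (G.comp g' g) h'' :=
  Subtype.ext (funext fun a => SmoothGroupoid.conj_conj (h.trans (φ.tgt_apply a).symm)
    ((φ.src_apply a).trans h.symm) (h'.trans (φ.base_conj h)))

lemma conj_inv_conj (h : G.src g = φ.base) (h' : G.src (G.inv g) = (φ.conj g h).base) :
    (φ.conj g h).conj (G.inv g) h' = φ :=
  Subtype.ext (funext fun a => inv_conj_conj (h.trans (φ.tgt_apply a).symm)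
    ((φ.src_apply a).trans h.symm))

lemma conj_congr {φ ψ : G.Frame T} {g g' : G.Arr} (hφ : φ = ψ) (hg : g = g')
    (h : G.src g = φ.base) (h' : G.src g' = ψ.base) : φ.conj g h = ψ.conj g' h' := by
  subst hφ hg; rfl

lemma _root_.Continuous.frameConj {X : Type*} [TopologicalSpace X] {a : X → G.Arr}
    {b : X → G.Frame T} (ha : Continuous a) (hb : Continuous b)
    (h : ∀ x, G.src (a x) = (b x).base) :
    Continuous (fun x => (b x).conj (a x) (h x)) := by
  refine Continuous.subtype_mk (continuous_pi fun c => ?_) _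
  exact ha.groupoidConj ((continuous_apply c).comp hb)
    (fun x => (h x).trans ((b x).tgt_apply c).symm) (fun x => ((b x).src_apply c).trans (h x).symm)

end Conj

section Action

variable {EK : Type*} [NormedAddCommGroup EK] [NormedSpace ℝ EK] {HK : Type*} [TopologicalSpace HK]
  {IK : ModelWithCorners ℝ EK HK}
  {K : Type*} [TopologicalSpace K] [ChartedSpace HK K] [Group K] (α : G.RightAction IK K)

/-- The translate of a frame by a group acting on the groupoid. -/
def translate (φ : G.Frame T) (k : K) : G.Frame T :=
  ⟨fun a => α.arr (φ.1 a) k,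
    { src_eq := fun a b => by rw [α.src_act, α.src_act, φ.src_apply, φ.src_apply]
      tgt_eq := fun a => by rw [α.src_act, α.tgt_act, φ.src_apply, φ.tgt_apply]
      map_mul := fun a b => by
        rw [φ.map_mul, α.comp_act ((φ.src_apply a).trans (φ.tgt_apply b).symm)]
      injective := fun a b hab => φ.2.injective (by
        rw [← α.arr_inv_arr (φ.1 a) k, ← α.arr_inv_arr (φ.1 b) k]
        exact congrArg (fun g => α.arr g k⁻¹) hab)
      exists_eq := fun g h h' => by
        rw [α.src_act] at h h'
        obtain ⟨a, ha⟩ := φ.2.exists_eq (α.arr g k⁻¹)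
          (by rw [α.src_act, h, α.obj_inv_obj]) (by rw [α.tgt_act, h', α.obj_inv_obj])
        exact ⟨a, by rw [ha, α.arr_arr_inv]⟩ }⟩

lemma base_translate (φ : G.Frame T) (k : K) : (φ.translate α k).base = α.obj φ.base k :=
  α.src_act _ _

end Action

end Frame

end SmoothGroupoid

/-! ### The frame space is étale over the space of objects -/

namespace SmoothGroupoid

variable {G : SmoothGroupoid.{u}} [hG : G.IsOrbifold] {T : Type v} [Group T]

namespace Frame

/-- The local section of the source map through `φ.1 a` takes the value `φ.1 a` at the base point.
These sections are the candidates for frames at nearby objects. -/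
lemma tendsto_localInverse (φ : G.Frame T) (a : T) :
    Filter.Tendsto (hG.etale (φ.1 a)).localInverse (𝓝 φ.base) (𝓝 (φ.1 a)) := by
  have hl := hG.etale (φ.1 a)
  have h1 : ContinuousAt hl.localInverse (G.src (φ.1 a)) :=
    hl.localInverse_contMDiffAt.continuousAt
  have h2 : hl.localInverse (G.src (φ.1 a)) = φ.1 a :=
    hl.localInverse_left_inv hl.localInverse_mem_target
  unfold ContinuousAt at h1
  rwa [h2, φ.src_apply] at h1

/-- In a purely ineffective orbifold groupoid, the arrows of a frame extend locally to sections
of the source map, which form frames at all nearby objects. -/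
lemma eventually_isFrame [Finite T] (hPI : G.IsPurelyIneffective) (φ : G.Frame T) :
    ∀ᶠ y in 𝓝 φ.base, G.IsFrame (fun a => (hG.etale (φ.1 a)).localInverse y) ∧
      ∀ a, G.src ((hG.etale (φ.1 a)).localInverse y) = y := by
  have hσ := φ.tendsto_localInverse
  have hsrc : ∀ a, ∀ᶠ y in 𝓝 φ.base, G.src ((hG.etale (φ.1 a)).localInverse y) = y := by
    intro a
    have h1 := (hG.etale (φ.1 a)).localInverse_eventuallyEq_right
    rw [φ.src_apply] at h1
    exact h1
  have htgt : ∀ a, ∀ᶠ y in 𝓝 φ.base, G.src ((hG.etale (φ.1 a)).localInverse y) =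
      G.tgt ((hG.etale (φ.1 a)).localInverse y) := by
    intro a
    -- Pure ineffectiveness enters here: arrows near an ineffective stabilizer arrow are again
    -- stabilizer arrows.
    have h1 : φ.1 a ∈ G.ineffectiveSpace := by
      rw [hPI]
      exact (φ.2.tgt_eq a).symm
    exact (hσ a).eventually ((G.mem_ineffectiveSpace_iff _).1 h1)
  -- Both sides are local sections of the étale source map through `φ.1 (a * b)`, so they agree near
  -- the base point.
  have hmul : ∀ a b, ∀ᶠ y in 𝓝 φ.base, (hG.etale (φ.1 (a * b))).localInverse y =
      G.comp ((hG.etale (φ.1 a)).localInverse y) ((hG.etale (φ.1 b)).localInverse y) := by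
    intro a b
    have hab : G.src (φ.1 a) = G.tgt (φ.1 b) := (φ.src_apply a).trans (φ.tgt_apply b).symm
    have h1 : ∀ᶠ y in 𝓝 φ.base, G.src ((hG.etale (φ.1 a)).localInverse y) =
        G.tgt ((hG.etale (φ.1 b)).localInverse y) := by
      filter_upwards [hsrc a, hsrc b, htgt b] with y h1 h2 h3
      rw [h1, ← h3, h2]
    have h2 : Filter.Tendsto (fun y => G.comp ((hG.etale (φ.1 a)).localInverse y)
        ((hG.etale (φ.1 b)).localInverse y)) (𝓝 φ.base) (𝓝 (φ.1 (a * b))) := by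
      rw [φ.map_mul]
      exact (continuousOn_comp (φ.1 a, φ.1 b) hab).tendsto.comp
        (tendsto_nhdsWithin_iff.2 ⟨(hσ a).prodMk_nhds (hσ b), h1⟩)
    filter_upwards [h1, h2.eventually (hG.etale (φ.1 (a * b))).localInverse_eventuallyEq_left,
      hsrc b] with y h3 h4 h5
    rw [Function.comp, src_comp h3, h5] at h4
    exact h4
  have hinj : ∀ a b, a ≠ b → ∀ᶠ y in 𝓝 φ.base, (hG.etale (φ.1 a)).localInverse y ≠
      (hG.etale (φ.1 b)).localInverse y :=
    fun a b hab => ((hσ a).prodMk_nhds (hσ b)).eventually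
      (isClosed_diagonal.isOpen_compl.mem_nhds (φ.2.injective.ne hab))
  -- The arrows off the chosen sheets form a closed set, whose image under the proper map (src, tgt)
  -- is closed. That image misses the diagonal point over `φ.base`, where the frame exhausts the
  -- stabilizer, and therefore misses nearby diagonal points.
  have hsurj : ∀ᶠ y in 𝓝 φ.base, ∀ g, G.src g = y → G.tgt g = y →
      ∃ a, (hG.etale (φ.1 a)).localInverse y = g := by
    have hC : IsClosed (⋃ a, (hG.etale (φ.1 a)).localInverse.target)ᶜ :=
      (isOpen_iUnion fun a => (hG.etale (φ.1 a)).localInverse.open_target).isClosed_compl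
    have hC' := hG.proper.isClosedMap _ hC
    have hd : Continuous (fun y : G.Obj => (y, y)) := continuous_id.prodMk continuous_id
    have hmem : φ.base ∈ ((fun y : G.Obj => (y, y)) ⁻¹'
        ((fun g : G.Arr => (G.src g, G.tgt g)) ''
          (⋃ a, (hG.etale (φ.1 a)).localInverse.target)ᶜ))ᶜ := by
      rintro ⟨g, hg, hg'⟩
      obtain ⟨a, rfl⟩ := φ.2.exists_eq g (congrArg Prod.fst hg') (congrArg Prod.snd hg')
      exact hg (Set.mem_iUnion.2 ⟨a, (hG.etale (φ.1 a)).localInverse_mem_target⟩)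
    filter_upwards [(hC'.preimage hd).isOpen_compl.mem_nhds hmem] with y hy g hg hg'
    have : g ∈ ⋃ a, (hG.etale (φ.1 a)).localInverse.target := by
      by_contra hn
      exact hy ⟨g, hn, Prod.ext hg hg'⟩
    obtain ⟨a, ha⟩ := Set.mem_iUnion.1 this
    exact ⟨a, by rw [← hg]; exact (hG.etale (φ.1 a)).localInverse_left_inv ha⟩
  -- Finiteness of `T` allows one neighbourhood to serve all pairs at once.
  have hinj' : ∀ᶠ y in 𝓝 φ.base, ∀ a b, a ≠ b → (hG.etale (φ.1 a)).localInverse y ≠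
      (hG.etale (φ.1 b)).localInverse y := by
    simp only [Filter.eventually_all]
    exact hinj
  filter_upwards [Filter.eventually_all.2 hsrc, Filter.eventually_all.2 htgt,
    Filter.eventually_all.2 fun a => Filter.eventually_all.2 (hmul a), hinj', hsurj]
    with y h1 h2 h3 h4 h5
  refine ⟨⟨fun a b => by rw [h1, h1], fun a => (h2 a).symm, h3, fun a b hab => ?_, ?_⟩, h1⟩
  · by_contra hn
    exact h4 a b hn hab
  · intro g hg hg'
    rw [h1] at hg hg'
    exact h5 g hg hg'

/-- Openness comes from extending a frame to frames at all nearby objects. Local injectivity holds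
because on a fixed sheet of the source map an arrow is determined by its source. -/
lemma isLocalHomeomorph_base [Finite T] (hPI : G.IsPurelyIneffective) :
    IsLocalHomeomorph (base : G.Frame T → G.Obj) := by
  have hopen : IsOpenMap (base : G.Frame T → G.Obj) := by
    rw [isOpenMap_iff_nhds_le]
    intro φ s hs
    rw [Filter.mem_map] at hs
    obtain ⟨W, hW, hWs⟩ := mem_nhds_induced Subtype.val φ _ |>.1 hs
    have hσ : Filter.Tendsto (fun y a => (hG.etale (φ.1 a)).localInverse y) (𝓝 φ.base)
        (𝓝 φ.1) := by
      exact tendsto_pi_nhds.2 φ.tendsto_localInverse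
    filter_upwards [eventually_isFrame hPI φ, hσ hW] with y hy hy'
    have h1 : (⟨_, hy.1⟩ : G.Frame T) ∈ base ⁻¹' s := hWs hy'
    have h2 : base (⟨_, hy.1⟩ : G.Frame T) = y := hy.2 1
    rwa [Set.mem_preimage, h2] at h1
  rw [isLocalHomeomorph_iff_isOpenEmbedding_restrict]
  intro φ
  -- The frames whose values lie on the same sheets as those of `φ`. This set is open since `T` is
  -- finite.
  let U : Set (G.Frame T) := ⋂ a, (fun ψ : G.Frame T => ψ.1 a) ⁻¹'
    (hG.etale (φ.1 a)).localInverse.target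
  have hU : IsOpen U := isOpen_iInter_of_finite fun a =>
    (hG.etale (φ.1 a)).localInverse.open_target.preimage (continuous_apply a)
  refine ⟨U, hU.mem_nhds (Set.mem_iInter.2 fun a => (hG.etale (φ.1 a)).localInverse_mem_target), ?_⟩
  refine Topology.IsOpenEmbedding.of_continuous_injective_isOpenMap
    (continuous_base.comp continuous_subtype_val) ?_ (hopen.domRestrict hU)
  rintro ⟨ψ, hψ⟩ ⟨ψ', hψ'⟩ h
  refine Subtype.ext (Subtype.ext (funext fun a => ?_))
  have h1 := (hG.etale (φ.1 a)).localInverse_left_inv (Set.mem_iInter.1 hψ a)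
  have h2 := (hG.etale (φ.1 a)).localInverse_left_inv (Set.mem_iInter.1 hψ' a)
  rw [src_apply] at h1 h2
  have h3 : ψ.base = ψ'.base := h
  rw [h3] at h1
  exact h1.symm.trans h2

/-- If some stabilizer is isomorphic to `T`, then all of them are, for a connected groupoid. -/
lemma surjective_base [Finite T] (hconn : G.IsConnected) (hPI : G.IsPurelyIneffective)
    (φ₀ : G.Frame T) : Function.Surjective (base : G.Frame T → G.Obj) := by
  have : ConnectedSpace G.Coarse := hconn
  let S : Set G.Obj := Set.range (base : G.Frame T → G.Obj)
  have hS : IsOpen S := (isLocalHomeomorph_base hPI).isOpenMap.isOpen_range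
  have hSc : IsOpen Sᶜ := by
    rw [isOpen_iff_mem_nhds]
    intro y hy
    -- Objects near `y` are framed by the stabilizer of `y` itself. If one of them also had a
    -- `T`-frame, the two groups would be isomorphic and `y` would have a `T`-frame too.
    have h1 := eventually_isFrame hPI (ofStab y)
    rw [base_ofStab] at h1
    filter_upwards [h1] with z hz
    rintro ⟨ψ, hψ⟩
    let χ : G.Frame (G.Stab y) := ⟨_, hz.1⟩
    have hχ : χ.base = z := hz.2 1
    obtain ⟨e, -⟩ := χ.exists_mulEquiv ψ (hχ.trans hψ.symm)
    exact hy ⟨(ofStab y).precomp e, by rw [base_precomp, base_ofStab]⟩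
  have hsat : ∀ g : G.Arr, G.src g ∈ S → G.tgt g ∈ S := by
    rintro g ⟨φ, hφ⟩
    exact ⟨φ.conj g hφ.symm, φ.base_conj _⟩
  -- Only the quotient is connected, so the clopen set is pushed there; saturation ensures that its
  -- preimage is again `S`.
  let Q : Set G.Coarse := Quotient.mk G.orbitSetoid '' S
  have hQ : Quotient.mk G.orbitSetoid ⁻¹' Q = S := by
    refine Set.Subset.antisymm ?_ (Set.subset_preimage_image _ _)
    rintro y ⟨z, hz, hzy⟩
    obtain ⟨g, rfl, rfl⟩ := Quotient.exact hzy
    exact hsat g hz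
  have hclopen : IsClopen Q := by
    refine ⟨⟨?_⟩, ?_⟩
    · rw [← isQuotientMap_quotient_mk'.isOpen_preimage]
      change IsOpen (Quotient.mk G.orbitSetoid ⁻¹' Qᶜ)
      rwa [Set.preimage_compl, hQ]
    · rw [← isQuotientMap_quotient_mk'.isOpen_preimage]
      change IsOpen (Quotient.mk G.orbitSetoid ⁻¹' Q)
      rwa [hQ]
  have huniv : Q = Set.univ := hclopen.eq_univ ⟨_, φ₀.base, ⟨φ₀, rfl⟩, rfl⟩
  intro y
  have : y ∈ Quotient.mk G.orbitSetoid ⁻¹' Q := by rw [huniv]; trivial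
  rwa [hQ] at this

end Frame

end SmoothGroupoid

/-- The pullback of a local homeomorphism is a local homeomorphism. -/
lemma IsLocalHomeomorph.snd_pullback {X Y B : Type*} [TopologicalSpace X] [TopologicalSpace Y]
    [TopologicalSpace B] {f : X → B} (hf : IsLocalHomeomorph f) {g : Y → B} (hg : Continuous g) :
    IsLocalHomeomorph (fun p : {p : X × Y // f p.1 = g p.2} => p.1.2) := by
  have hc : Continuous (fun p : {p : X × Y // f p.1 = g p.2} => p.1.2) :=
    continuous_snd.comp continuous_subtype_val
  have hopen : IsOpenMap (fun p : {p : X × Y // f p.1 = g p.2} => p.1.2) := by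
    rw [isOpenMap_iff_nhds_le]
    rintro ⟨⟨x, y⟩, hxy⟩ s hs
    obtain ⟨W, hW, hWs⟩ := mem_nhds_induced Subtype.val _ _ |>.1 hs
    obtain ⟨e, hx, rfl⟩ := hf x
    have hx' : g y ∈ e.target := by
      rw [← show e x = g y from hxy]
      exact e.map_source hx
    -- The local inverse of `f` induces a continuous local section of the pullback through the given
    -- point, which yields openness.
    have h1 : Filter.Tendsto (fun z => (e.symm (g z), z)) (𝓝 y) (𝓝 (x, y)) := by
      have h2 : ContinuousAt (fun z => (e.symm (g z), z)) y :=
        ContinuousAt.prodMk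
          (ContinuousAt.comp (g := e.symm) (e.continuousAt_symm hx') hg.continuousAt)
          continuousAt_id
      have h3 : e.symm (g y) = x := by
        rw [← show e x = g y from hxy]
        exact e.left_inv hx
      have h4 := h2.tendsto
      rwa [h3] at h4
    filter_upwards [h1 hW, hg.continuousAt.preimage_mem_nhds (e.open_target.mem_nhds hx')]
      with z hz hz'
    exact hWs (show (⟨(e.symm (g z), z), e.right_inv hz'⟩ :
      {p : X × Y // e p.1 = g p.2}) ∈ Subtype.val ⁻¹' W from hz)
  rw [isLocalHomeomorph_iff_isOpenEmbedding_restrict]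
  rintro ⟨⟨x, y⟩, hxy⟩
  obtain ⟨e, hx, rfl⟩ := hf x
  have hU : IsOpen {p : {p : X × Y // e p.1 = g p.2} | p.1.1 ∈ e.source} :=
    e.open_source.preimage (continuous_fst.comp continuous_subtype_val)
  refine ⟨_, hU.mem_nhds hx, Topology.IsOpenEmbedding.of_continuous_injective_isOpenMap
    (hc.comp continuous_subtype_val) ?_ (hopen.domRestrict hU)⟩
  rintro ⟨⟨⟨a, b⟩, hab⟩, ha⟩ ⟨⟨⟨a', b'⟩, hab'⟩, ha'⟩ h
  obtain rfl : b = b' := h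
  obtain rfl : a = a' := e.injOn ha ha' ((show e a = g b from hab).trans
    (show e a' = g b from hab').symm)
  rfl

/-! ### The action groupoid on frames -/

namespace SmoothGroupoid

variable {G : SmoothGroupoid.{u}} {T : Type u} [Group T]

variable (G T) in
/-- The arrows of the action groupoid of `G` on the space of frames: pairs of an arrow of `G` and
a frame at its source. -/
abbrev FrameArr : Type u := {p : G.Arr × G.Frame T // G.src p.1 = p.2.base}

namespace FrameArr

/-- The arrow of `G`. -/
def arr (p : G.FrameArr T) : G.Arr := p.1.1

/-- The frame at the source. -/
def src (p : G.FrameArr T) : G.Frame T := p.1.2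

lemma src_arr (p : G.FrameArr T) : G.src p.arr = p.src.base := p.2

/-- The frame at the target. -/
def tgt (p : G.FrameArr T) : G.Frame T := p.src.conj p.arr p.src_arr

lemma base_tgt (p : G.FrameArr T) : p.tgt.base = G.tgt p.arr := p.src.base_conj _

@[ext]
lemma ext {p q : G.FrameArr T} (ha : p.arr = q.arr) (hs : p.src = q.src) : p = q :=
  Subtype.ext (Prod.ext ha hs)

/-- The arrow out of a frame `φ` given by an arrow out of its base. -/
def mk (g : G.Arr) (φ : G.Frame T) (h : G.src g = φ.base) : G.FrameArr T := ⟨(g, φ), h⟩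

lemma src_mk (g : G.Arr) (φ : G.Frame T) (h : G.src g = φ.base) : (mk g φ h).src = φ := rfl

lemma continuous_arr : Continuous (arr : G.FrameArr T → G.Arr) :=
  continuous_fst.comp continuous_subtype_val

lemma continuous_src : Continuous (src : G.FrameArr T → G.Frame T) :=
  continuous_snd.comp continuous_subtype_val

lemma continuous_tgt : Continuous (tgt : G.FrameArr T → G.Frame T) :=
  continuous_arr.frameConj continuous_src src_arr

lemma _root_.Continuous.frameArrMk {X : Type*} [TopologicalSpace X] {a : X → G.Arr}
    {b : X → G.Frame T} (ha : Continuous a) (hb : Continuous b)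
    (h : ∀ x, G.src (a x) = (b x).base) :
    Continuous (fun x => mk (a x) (b x) (h x)) :=
  (ha.prodMk hb).subtype_mk _

/-- The identity of a frame. -/
def unit (φ : G.Frame T) : G.FrameArr T := mk (G.unit φ.base) φ (G.src_unit _)

/-- The inverse of an arrow between frames. -/
def inv (p : G.FrameArr T) : G.FrameArr T :=
  mk (G.inv p.arr) p.tgt (by rw [G.src_inv, p.base_tgt])

lemma src_arr_eq_of_src_eq {p q : G.FrameArr T} (e : p.src = q.tgt) :
    G.src p.arr = G.tgt q.arr := by
  rw [p.src_arr, e, q.base_tgt]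

/-- The composite of two arrows between frames. -/
def mul (p q : G.FrameArr T) (e : p.src = q.tgt) : G.FrameArr T :=
  mk (G.comp p.arr q.arr) q.src (by rw [src_comp (src_arr_eq_of_src_eq e), q.src_arr])

lemma tgt_unit (φ : G.Frame T) : (unit φ).tgt = φ := φ.conj_unit _

lemma tgt_inv (p : G.FrameArr T) : p.inv.tgt = p.src := p.src.conj_inv_conj p.src_arr _

lemma tgt_mul (p q : G.FrameArr T) (e : p.src = q.tgt) : (mul p q e).tgt = p.tgt := by
  have h : G.src p.arr = (q.src.conj q.arr q.src_arr).base :=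
    p.src_arr.trans (congrArg Frame.base e)
  exact (q.src.conj_conj q.src_arr h _).symm.trans (Frame.conj_congr e.symm rfl _ _)

lemma continuous_mul : Continuous (fun p : {p : G.FrameArr T × G.FrameArr T | p.1.src = p.2.tgt} =>
    mul p.1.1 p.1.2 p.2) :=
  Continuous.frameArrMk (Continuous.groupoidComp
    (continuous_arr.comp (continuous_fst.comp continuous_subtype_val))
    (continuous_arr.comp (continuous_snd.comp continuous_subtype_val))
    fun p => src_arr_eq_of_src_eq p.2)
    (continuous_src.comp (continuous_snd.comp continuous_subtype_val)) _

variable [hG : G.IsOrbifold]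

lemma isLocalHomeomorph_src : IsLocalHomeomorph (src : G.FrameArr T → G.Frame T) :=
  IsLocalHomeomorph.snd_pullback hG.etale.isLocalHomeomorph Frame.continuous_base

/-- Passing to base points while remembering the source frame turns this map into the restriction of
the proper map (src, tgt) × id to a closed subset. Since the space of pairs of frames is Hausdorff,
properness of the composite implies properness of the first map. -/
lemma isProperMap_src_tgt :
    IsProperMap (fun p : G.FrameArr T => (p.src, p.tgt)) := by
  have h1 : Topology.IsClosedEmbedding (Subtype.val : G.FrameArr T → G.Arr × G.Frame T) :=
    (isClosed_eq (G.smooth_src.continuous.comp continuous_fst)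
      (Frame.continuous_base.comp continuous_snd)).isClosedEmbedding_subtypeVal
  have h2 : IsProperMap (Prod.map (fun g : G.Arr => (G.src g, G.tgt g)) (id : G.Frame T → _) ∘
      (Subtype.val : G.FrameArr T → G.Arr × G.Frame T)) :=
    (hG.proper.prodMap isProperMap_id).comp h1.isProperMap
  refine isProperMap_of_comp_of_t2 (g := fun q : G.Frame T × G.Frame T =>
    ((q.1.base, q.2.base), q.1)) (FrameArr.continuous_src.prodMk FrameArr.continuous_tgt) ?_ ?_
  · exact ((Frame.continuous_base.comp continuous_fst).prodMk
      (Frame.continuous_base.comp continuous_snd)).prodMk continuous_fst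
  · convert h2 using 1
    funext p
    exact Prod.ext (Prod.ext p.src_arr.symm p.base_tgt) rfl

lemma isLocalHomeomorph_base_src [Finite T] (hPI : G.IsPurelyIneffective) :
    IsLocalHomeomorph (fun p : G.FrameArr T => p.src.base) :=
  (Frame.isLocalHomeomorph_base hPI).comp isLocalHomeomorph_src

end FrameArr

variable [hG : G.IsOrbifold] [Finite T] (hPI : G.IsPurelyIneffective)

instance : SecondCountableTopology (G.Frame T) :=
  Topology.IsInducing.subtypeVal.secondCountableTopology

instance : SecondCountableTopology (G.FrameArr T) :=
  Topology.IsInducing.subtypeVal.secondCountableTopology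

variable (T) in
/-- The manifold of frames. -/
def frameMfd : Mfd.{u} := Mfd.etale (Frame.isLocalHomeomorph_base (T := T) hPI)

variable (T) in
/-- The manifold of arrows between frames. -/
def frameArrMfd : Mfd.{u} := Mfd.etale (FrameArr.isLocalHomeomorph_base_src (T := T) hPI)

lemma isLocalDiffeomorph_frameBase :
    IsLocalDiffeomorph (M := frameMfd T hPI) (frameMfd T hPI).I G.Obj.I ∞ Frame.base :=
  Mfd.isLocalDiffeomorph_etale _

lemma isLocalDiffeomorph_frameArrBase :
    IsLocalDiffeomorph (M := frameArrMfd T hPI) (frameArrMfd T hPI).I G.Obj.I ∞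
      (fun p : G.FrameArr T => p.src.base) :=
  Mfd.isLocalDiffeomorph_etale _

lemma isLocalDiffeomorph_frameArrSrc :
    IsLocalDiffeomorph (M := frameArrMfd T hPI) (N := frameMfd T hPI)
      (frameArrMfd T hPI).I (frameMfd T hPI).I ∞ FrameArr.src :=
  IsLocalDiffeomorph.of_comp (M := frameArrMfd T hPI) (N := frameMfd T hPI)
    (isLocalDiffeomorph_frameBase hPI) FrameArr.continuous_src (isLocalDiffeomorph_frameArrBase hPI)

lemma contMDiff_frameArrArr :
    ContMDiff (M := frameArrMfd T hPI) (frameArrMfd T hPI).I G.Arr.I ∞ FrameArr.arr := by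
  refine ContMDiff.of_isLocalDiffeomorph_comp (M := frameArrMfd T hPI) hG.etale
    FrameArr.continuous_arr ?_
  exact (isLocalDiffeomorph_frameArrBase hPI).contMDiff.congr fun p => FrameArr.src_arr p

section Smooth

variable {E' : Type*} [NormedAddCommGroup E'] [NormedSpace ℝ E'] {H' : Type*} [TopologicalSpace H']
  {I' : ModelWithCorners ℝ E' H'} {N : Type*} [TopologicalSpace N] [ChartedSpace H' N]

/-- The base map is étale, so a continuous map to frames is a lift of its base map. The smooth
structure maps and actions on frames are all obtained from this lemma and its variants for arrows.
-/
lemma contMDiff_frameMfd {f : N → G.Frame T} (hf : Continuous f)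
    (h : ContMDiff I' G.Obj.I ∞ (fun x => (f x).base)) :
    ContMDiff (M' := frameMfd T hPI) I' (frameMfd T hPI).I ∞ f :=
  ContMDiff.of_isLocalDiffeomorph_comp (N := frameMfd T hPI) (isLocalDiffeomorph_frameBase hPI) hf h

lemma contMDiff_frameArrMfd {f : N → G.FrameArr T} (hf : Continuous f)
    (h : ContMDiff I' G.Obj.I ∞ (fun x => (f x).src.base)) :
    ContMDiff (M' := frameArrMfd T hPI) I' (frameArrMfd T hPI).I ∞ f :=
  ContMDiff.of_isLocalDiffeomorph_comp (N := frameArrMfd T hPI)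
    (isLocalDiffeomorph_frameArrBase hPI) hf h

lemma smoothOnSubset_frameArrMfd {A : Set N} {f : A → G.FrameArr T} (hf : Continuous f)
    {F : N → G.Obj} (hF : ContMDiff I' G.Obj.I ∞ F) (h : ∀ a : A, F a = (f a).src.base) :
    SmoothOnSubset (N := frameArrMfd T hPI) I' (frameArrMfd T hPI).I A f :=
  SmoothOnSubset.of_isLocalDiffeomorph (N := frameArrMfd T hPI)
    (isLocalDiffeomorph_frameArrBase hPI) hf hF h

end Smooth

variable (T) in
/-- The action groupoid of `G` on its space of `T`-frames. -/
def frameGroupoid : SmoothGroupoid.{u} where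
  Obj := frameMfd T hPI
  Arr := frameArrMfd T hPI
  src := FrameArr.src
  tgt := FrameArr.tgt
  unit := FrameArr.unit
  inv := FrameArr.inv
  mul := FrameArr.mul
  src_unit _ := rfl
  tgt_unit := FrameArr.tgt_unit
  src_inv _ := rfl
  tgt_inv := FrameArr.tgt_inv
  src_mul _ _ _ := rfl
  tgt_mul := FrameArr.tgt_mul
  mul_assoc g h k e e' := FrameArr.ext
    (comp_assoc (FrameArr.src_arr_eq_of_src_eq e) (FrameArr.src_arr_eq_of_src_eq e')).symm rfl
  mul_unit g := FrameArr.ext (comp_unit (FrameArr.src_arr g)) rfl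
  unit_mul g := FrameArr.ext (unit_comp (FrameArr.base_tgt g)) rfl
  inv_mul g := FrameArr.ext ((inv_comp _).trans (congrArg G.unit (FrameArr.src_arr g))) rfl
  mul_inv g := FrameArr.ext
    ((comp_inv _).trans (congrArg G.unit (FrameArr.base_tgt g).symm)) rfl
  smooth_src := (isLocalDiffeomorph_frameArrSrc hPI).contMDiff
  smooth_tgt := by
    refine contMDiff_frameMfd hPI (N := frameArrMfd T hPI) FrameArr.continuous_tgt ?_
    exact (G.smooth_tgt.comp (contMDiff_frameArrArr hPI)).congr fun p => FrameArr.base_tgt p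
  smooth_unit := by
    refine contMDiff_frameArrMfd hPI (N := frameMfd T hPI) ?_
      (isLocalDiffeomorph_frameBase hPI).contMDiff
    exact (G.smooth_unit.continuous.comp Frame.continuous_base).frameArrMk continuous_id _
  smooth_inv := by
    refine contMDiff_frameArrMfd hPI (N := frameArrMfd T hPI) ?_ ?_
    · exact (G.smooth_inv.continuous.comp FrameArr.continuous_arr).frameArrMk
        FrameArr.continuous_tgt _
    · exact (G.smooth_tgt.comp (contMDiff_frameArrArr hPI)).congr fun p => FrameArr.base_tgt p
  smooth_mul := smoothOnSubset_frameArrMfd (N := frameArrMfd T hPI × frameArrMfd T hPI) hPI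
    FrameArr.continuous_mul
    ((isLocalDiffeomorph_frameArrBase hPI).contMDiff.comp contMDiff_snd) fun _ => rfl
  submersion_src := (isLocalDiffeomorph_frameArrSrc hPI).isSmoothSubmersion

instance : (frameGroupoid T hPI).IsOrbifold where
  etale := isLocalDiffeomorph_frameArrSrc hPI
  proper := FrameArr.isProperMap_src_tgt

/-- An arrow fixing its frame lies over a stabilizer arrow of `G`, which is ineffective. So the
source and target frames of a nearby arrow have the same base point. Both are close to the fixed
frame, where the base map is injective, so they are equal. -/
lemma isPurelyIneffective_frameGroupoid : (frameGroupoid T hPI).IsPurelyIneffective := by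
  refine Set.Subset.antisymm (fun p hp => hp.1) fun (p : G.FrameArr T) (hp : p.src = p.tgt) => ?_
  refine (mem_ineffectiveSpace_iff (frameGroupoid T hPI) p).2 ?_
  change ∀ᶠ q : G.FrameArr T in 𝓝 p, q.src = q.tgt
  have hg : p.arr ∈ G.ineffectiveSpace := by
    rw [hPI]
    exact FrameArr.src_arr_eq_of_src_eq hp
  obtain ⟨U, hU, hpU, hinj⟩ := (Frame.isLocalHomeomorph_base hPI).isLocallyInjective p.src
  have h1 := FrameArr.continuous_arr.continuousAt.eventually
    ((G.mem_ineffectiveSpace_iff _).1 hg)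
  have h2 := FrameArr.continuous_src.continuousAt.preimage_mem_nhds (hU.mem_nhds hpU)
  have h3 := FrameArr.continuous_tgt.continuousAt.preimage_mem_nhds (hU.mem_nhds (hp ▸ hpU))
  filter_upwards [h1, h2, h3] with q hq1 hq2 hq3
  refine hinj hq2 hq3 ?_
  rw [q.base_tgt, ← hq1, q.src_arr]

end SmoothGroupoid

/-- The element of `A` underlying an element of the discrete manifold `Disc A`. -/
def Disc.out {A : Type u} (a : Disc A) : A := a

namespace SmoothGroupoid

/-! ### The action of `K × Aut T` on the frame groupoid -/

section Action

variable {G : SmoothGroupoid.{u}} {T : Type u} [Group T]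
  {EK : Type*} [NormedAddCommGroup EK] [NormedSpace ℝ EK] {HK : Type*} [TopologicalSpace HK]
  {IK : ModelWithCorners ℝ EK HK}
  {K : Type*} [TopologicalSpace K] [ChartedSpace HK K] [Group K] (α : G.RightAction IK K)

/-- The right action of `K × Aut T` on frames. -/
def Frame.act (φ : G.Frame T) (k : K × Disc (MulAut T)) : G.Frame T :=
  (φ.precomp k.2.out).translate α k.1

lemma Frame.base_act (φ : G.Frame T) (k : K × Disc (MulAut T)) :
    (φ.act α k).base = α.obj φ.base k.1 := by
  rw [act, base_translate, base_precomp]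

lemma Frame.act_one (φ : G.Frame T) : φ.act α 1 = φ :=
  Subtype.ext (funext fun _ => α.arr_one _)

lemma Frame.act_one_left (φ : G.Frame T) (l : Disc (MulAut T)) :
    φ.act α (1, l) = φ.precomp l.out :=
  Subtype.ext (funext fun _ => α.arr_one _)

lemma Frame.act_mul (φ : G.Frame T) (k l : K × Disc (MulAut T)) :
    φ.act α (k * l) = (φ.act α k).act α l :=
  Subtype.ext (funext fun _ => α.arr_mul _ _ _)

lemma Frame.conj_act (φ : G.Frame T) {g : G.Arr} (h : G.src g = φ.base)
    (k : K × Disc (MulAut T)) (h' : G.src (α.arr g k.1) = (φ.act α k).base) :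
    (φ.conj g h).act α k = (φ.act α k).conj (α.arr g k.1) h' :=
  Subtype.ext (funext fun _ => α.conj_act (h.trans (φ.tgt_apply _).symm)
    ((φ.src_apply _).trans h.symm) _)

lemma Frame.continuous_act :
    Continuous (fun p : G.Frame T × (K × Disc (MulAut T)) => p.1.act α p.2) := by
  refine Continuous.subtype_mk (continuous_pi fun a => ?_) _
  refine α.smooth_arr.continuous.comp (f := fun p : G.Frame T × (K × Disc (MulAut T)) =>
    (p.1.1 (p.2.2.out a), p.2.1)) (Continuous.prodMk ?_
      (continuous_fst.comp continuous_snd))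
  -- Since the automorphism group is discrete, joint continuity of evaluation may be checked for
  -- each fixed automorphism.
  have h : Continuous (fun q : Disc (MulAut T) × G.Frame T => q.2.1 (q.1.out a)) :=
    continuous_prod_of_discrete_left.2 fun l => Frame.continuous_apply (l.out a)
  exact h.comp (f := fun p : G.Frame T × (K × Disc (MulAut T)) => (p.2.2, p.1))
    ((continuous_snd.comp continuous_snd).prodMk continuous_fst)

/-- The right action of `K × Aut T` on arrows between frames. -/
def FrameArr.act (p : G.FrameArr T) (k : K × Disc (MulAut T)) : G.FrameArr T :=
  mk (α.arr p.arr k.1) (p.src.act α k) (by rw [α.src_act, Frame.base_act, p.src_arr])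

lemma FrameArr.src_arr_eq_of_act_eq {g : G.FrameArr T × Disc (MulAut T)} {p : G.FrameArr T}
    (e : g.1.src.act α (1, g.2) = p.src) : G.src p.arr = G.src g.1.arr := by
  rw [p.src_arr, ← e, Frame.base_act, α.obj_one, g.1.src_arr]

lemma FrameArr.tgt_act (p : G.FrameArr T) (k : K × Disc (MulAut T)) :
    (p.act α k).tgt = p.tgt.act α k :=
  (p.src.conj_act α p.src_arr k _).symm

lemma FrameArr.continuous_act :
    Continuous (fun p : G.FrameArr T × (K × Disc (MulAut T)) => p.1.act α p.2) :=
  Continuous.frameArrMk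
    (α.smooth_arr.continuous.comp ((continuous_arr.comp continuous_fst).prodMk
      (continuous_fst.comp continuous_snd)))
    ((Frame.continuous_act α).comp ((continuous_src.comp continuous_fst).prodMk continuous_snd)) _

/-- The stabilizer arrow of a frame `φ` given by a central element of `T`. -/
def FrameArr.ofCenter (q : G.Frame T × Disc (Subgroup.center T)) : G.FrameArr T :=
  mk (q.1.1 q.2.out) q.1 (q.1.src_apply _)

lemma FrameArr.tgt_ofCenter (q : G.Frame T × Disc (Subgroup.center T)) :
    (ofCenter q).tgt = q.1 := by
  refine Subtype.ext (funext fun b => ?_)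
  symm
  refine (eq_conj_iff ((q.1.src_apply _).trans (q.1.tgt_apply _).symm)
    ((q.1.src_apply _).trans (q.1.src_apply _).symm)
    ((q.1.src_apply _).trans (q.1.tgt_apply _).symm)).2 ?_
  rw [← q.1.map_mul, ← q.1.map_mul,
    Subgroup.mem_center_iff.1 q.2.out.2 b]

/-- A stabilizer arrow at the base of φ is φ(a) for some a. Conjugation by it fixes φ exactly when
φ(a) commutes with every φ(b), which by injectivity of φ means that a is central. -/
lemma FrameArr.range_ofCenter :
    Set.range (ofCenter : _ → G.FrameArr T) = {p | p.src = p.tgt} := by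
  ext p
  constructor
  · rintro ⟨q, rfl⟩
    exact (tgt_ofCenter q).symm
  · intro (hp : p.src = p.tgt)
    obtain ⟨a, ha⟩ := p.src.2.exists_eq p.arr p.src_arr
      (by rw [← p.base_tgt, ← hp]; rfl)
    have hc : a ∈ Subgroup.center T := by
      refine Subgroup.mem_center_iff.2 fun b => p.src.2.injective ?_
      have h1 : p.src.1 b = G.conj p.arr (p.src.1 b) := congrArg (fun φ : G.Frame T => φ.1 b) hp
      rw [eq_conj_iff (p.src_arr.trans (p.src.tgt_apply _).symm)
        ((p.src.src_apply _).trans p.src_arr.symm)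
        (by rw [p.src.src_apply, ← p.base_tgt, ← hp]), ← ha, ← Frame.map_mul,
        ← Frame.map_mul] at h1
      exact h1
    exact ⟨(p.src, (⟨a, hc⟩ : Subgroup.center T)), FrameArr.ext ha rfl⟩

lemma FrameArr.continuous_ofCenter : Continuous (ofCenter : _ → G.FrameArr T) := by
  refine Continuous.frameArrMk ?_ continuous_fst _
  exact continuous_prod_of_discrete_right.2 fun a =>
    Frame.continuous_apply (a.out : T)

variable [hG : G.IsOrbifold] [Finite T] (hPI : G.IsPurelyIneffective)

lemma contMDiff_frameAct :
    ContMDiff (M := frameMfd T hPI × (K × Disc (MulAut T))) (M' := frameMfd T hPI)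
      ((frameMfd T hPI).I.prod (IK.prod Disc.model)) (frameMfd T hPI).I ∞
      (fun p => Frame.act α p.1 p.2) := by
  refine contMDiff_frameMfd hPI (N := frameMfd T hPI × (K × Disc (MulAut T)))
    (Frame.continuous_act α) ?_
  have h := α.smooth_obj.comp (((isLocalDiffeomorph_frameBase (T := T) hPI).contMDiff.comp
    (contMDiff_fst (I := (frameMfd T hPI).I) (J := IK.prod Disc.model)
      (N := K × Disc (MulAut T)))).prodMk (contMDiff_fst.comp contMDiff_snd))
  exact h.congr fun p => Frame.base_act α _ _

lemma contMDiff_frameArrAct :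
    ContMDiff (M := frameArrMfd T hPI × (K × Disc (MulAut T))) (M' := frameArrMfd T hPI)
      ((frameArrMfd T hPI).I.prod (IK.prod Disc.model)) (frameArrMfd T hPI).I ∞
      (fun p => FrameArr.act α p.1 p.2) := by
  refine contMDiff_frameArrMfd hPI (N := frameArrMfd T hPI × (K × Disc (MulAut T)))
    (FrameArr.continuous_act α) ?_
  have h := α.smooth_obj.comp (((isLocalDiffeomorph_frameArrBase (T := T) hPI).contMDiff.comp
    (contMDiff_fst (I := (frameArrMfd T hPI).I) (J := IK.prod Disc.model)
      (N := K × Disc (MulAut T)))).prodMk (contMDiff_fst.comp contMDiff_snd))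
  exact h.congr fun p => Frame.base_act α _ _

variable (T) in
/-- The right action of `K × Aut T` on the groupoid of frames. -/
def frameAction : (frameGroupoid T hPI).RightAction (IK.prod Disc.model)
    (K × Disc (MulAut T)) where
  obj := Frame.act α
  arr := FrameArr.act α
  obj_one := Frame.act_one α
  obj_mul := Frame.act_mul α
  arr_one _ := FrameArr.ext (α.arr_one _) (Frame.act_one α _)
  arr_mul _ _ _ := FrameArr.ext (α.arr_mul _ _ _) (Frame.act_mul α _ _ _)
  smooth_obj := contMDiff_frameAct α hPI
  smooth_arr := contMDiff_frameArrAct α hPI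
  unit_act φ k := FrameArr.ext
    ((α.unit_act _ _).trans (congrArg G.unit (Frame.base_act α φ k).symm)) rfl
  src_act _ _ := rfl
  tgt_act := FrameArr.tgt_act α
  mul_act _ _ e _ := FrameArr.ext (α.comp_act (FrameArr.src_arr_eq_of_src_eq e) _) rfl

/-- Over the objects of `G` this map becomes the étale base map after forgetting a discrete factor,
and a continuous lift of an étale map along an étale map is étale. -/
lemma isLocalDiffeomorph_ofCenter :
    IsLocalDiffeomorph (M := frameMfd T hPI × Disc (Subgroup.center T)) (N := frameArrMfd T hPI)
      ((frameMfd T hPI).I.prod Disc.model) (frameArrMfd T hPI).I ∞ FrameArr.ofCenter := by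
  refine IsLocalDiffeomorph.of_comp (M := frameMfd T hPI × Disc (Subgroup.center T))
    (N := frameArrMfd T hPI) (isLocalDiffeomorph_frameArrBase hPI) FrameArr.continuous_ofCenter ?_
  exact (isLocalDiffeomorph_frameBase hPI).comp isLocalDiffeomorph_fst_disc

variable (T) in
/-- The stabilizers of the frame groupoid are equivariantly trivialized by the center of `T`. -/
def frameTrivialization : StabilizerTrivialization (frameAction T α hPI) (Subgroup.center T)
    (fun a kl => Subgroup.centerCongr (kl.2 : MulAut T)⁻¹ a) where
  toFun := FrameArr.ofCenter
  src_toFun _ _ := rfl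
  tgt_toFun x a := FrameArr.tgt_ofCenter (x, a)
  localDiffeo := isLocalDiffeomorph_ofCenter hPI
  injective := by
    rintro ⟨φ, a⟩ ⟨ψ, b⟩ h
    obtain rfl : φ = ψ := congrArg FrameArr.src h
    exact Prod.ext rfl (Subtype.ext (Subtype.prop φ |>.injective (congrArg FrameArr.arr h)))
  range_eq := FrameArr.range_ofCenter.trans (isPurelyIneffective_frameGroupoid hPI).symm
  map_mul (φ : G.Frame T) a b := FrameArr.ext (φ.map_mul _ _) rfl
  conj (p : G.FrameArr T) (a : Subgroup.center T) := by
    refine FrameArr.ext ?_ rfl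
    -- The target frame is by construction the conjugate of the source frame, so conjugating back
    -- gives the original value.
    change p.src.1 a = G.comp (G.comp (G.inv p.arr) (G.conj p.arr (p.src.1 a))) p.arr
    have e : G.src p.arr = G.tgt (p.src.1 a) := p.src_arr.trans (p.src.tgt_apply _).symm
    have e' : G.src (p.src.1 a) = G.src p.arr := (p.src.src_apply _).trans p.src_arr.symm
    rw [comp_assoc (by rw [G.src_inv, tgt_conj e e']) (src_conj e e'), conj_comp_self e e',
      inv_comp_cancel_left e]
  equivariant (φ : G.Frame T) a kl := by
    refine FrameArr.ext ?_ rfl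
    -- The frame is precomposed with the automorphism while the central element is moved by its
    -- inverse, so the two cancel.
    change α.arr (φ.1 a) kl.1 = α.arr (φ.1 (kl.2.out
      (kl.2.out⁻¹ a))) kl.1
    rw [MulAut.apply_inv_self]

end Action

/-! ### Consequences of a trivialization of the stabilizers -/

section Trivialization

variable {G : SmoothGroupoid.{u}} [G.IsEtale]
  {EK : Type*} [NormedAddCommGroup EK] [NormedSpace ℝ EK] {HK : Type*} [TopologicalSpace HK]
  {IK : ModelWithCorners ℝ EK HK}
  {K : Type*} [TopologicalSpace K] [ChartedSpace HK K] [Group K]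

/-- Every ineffective stabilizer at `y` is a value of the trivialization over `y`, which is
multiplicative, so commutativity passes from `A`. -/
lemma StabilizerTrivialization.ineffStab_comm {α : G.RightAction IK K} {A : Type w} [Group A]
    {ρ : A → K → A} (c : StabilizerTrivialization α A ρ) (hA : ∀ a b : A, a * b = b * a)
    (y : G.Obj) (a b : G.ineffStab y) : a * b = b * a := by
  have h : ∀ a : G.ineffStab y, ∃ a' : Disc A, c.toFun (y, a') = a.1.arr := by
    intro a
    obtain ⟨⟨z, a'⟩, ha⟩ : a.1.arr ∈ Set.range c.toFun := by
      rw [c.range_eq]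
      exact a.2
    obtain rfl : z = y := by rw [← c.src_toFun z a', ha, a.1.src_eq]
    exact ⟨a', ha⟩
  obtain ⟨a', ha⟩ := h a
  obtain ⟨b', hb⟩ := h b
  refine Subtype.ext (Stab.ext ?_)
  change G.mul a.1.arr b.1.arr _ = G.mul b.1.arr a.1.arr _
  have h1 := c.map_mul y a' b'
  have h2 := c.map_mul y b' a'
  rw [show a' * b' = b' * a' from hA a' b', h2] at h1
  simp only [ha, hb] at h1
  exact h1.symm

variable {EL : Type} [NormedAddCommGroup EL] [NormedSpace ℝ EL] [FiniteDimensional ℝ EL]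
  {HL : Type} [TopologicalSpace HL]
  {IL : ModelWithCorners ℝ EL HL} [IL.Boundaryless]
  {L : Type u} [TopologicalSpace L] [ChartedSpace HL L] [Group L] [LieGroup IL ∞ L]
  [T2Space L] [SecondCountableTopology L]

/-- Restriction of a trivialization to the first factor of a product group. -/
def StabilizerTrivialization.fst {β : G.RightAction (IK.prod IL) (K × L)} {A : Type w} [Group A]
    {ρ : A → K × L → A} (c : StabilizerTrivialization β A ρ) (ρ' : A → K → A)
    (h : ∀ a k, ρ a (k, 1) = ρ' a k) : StabilizerTrivialization β.fst A ρ' where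
  toFun := c.toFun
  src_toFun := c.src_toFun
  tgt_toFun := c.tgt_toFun
  localDiffeo := c.localDiffeo
  injective := c.injective
  range_eq := c.range_eq
  map_mul := c.map_mul
  conj := c.conj
  equivariant x a k := (c.equivariant x a (k, 1)).trans (by rw [h]; rfl)

end Trivialization

end SmoothGroupoid

namespace SmoothGroupoid

/-! ### The bibundle between the frame groupoid and `G` -/

section Bibundle

variable {G : SmoothGroupoid.{u}} {T : Type u} [Group T]

namespace Frame

/-- Freeness of the action of Aut(T) on frames; it makes the automorphism comparing two frames
unique. -/
lemma precomp_injective (φ : G.Frame T) : Function.Injective (fun e : MulAut T => φ.precomp e) :=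
  fun _ _ h => MulEquiv.ext fun a =>
    φ.2.injective (congrArg (fun ψ : G.Frame T => ψ.1 a) h)

lemma continuous_precomp (e : MulAut T) : Continuous (fun φ : G.Frame T => φ.precomp e) :=
  Continuous.subtype_mk (continuous_pi fun a => continuous_apply (e a)) _

/-- The automorphism comparing two continuous families of frames is locally constant. -/
lemma continuous_of_precomp_eq [Finite T] {X : Type*} [TopologicalSpace X] {a b : X → G.Frame T}
    (ha : Continuous a) (hb : Continuous b) {l : X → Disc (MulAut T)}
    (h : ∀ x, (a x).precomp (l x).out = b x) : Continuous l := by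
  have hfin : Finite (Disc (MulAut T)) := inferInstanceAs (Finite (MulAut T))
  -- By freeness this preimage is the locus where two continuous maps to a Hausdorff space agree. As
  -- Aut(T) is finite, the preimage of any subset is a finite union of such closed sets.
  have h1 : ∀ e, IsClosed (l ⁻¹' {e}) := by
    intro e
    have : l ⁻¹' {e} = {x | (a x).precomp e.out = b x} := by
      ext x
      constructor
      · rintro rfl
        exact h x
      · intro hx
        exact (a x).precomp_injective ((h x).trans hx.symm)
    rw [this]
    exact isClosed_eq ((continuous_precomp _).comp ha) hb
  refine continuous_iff_isClosed.2 fun s _ => ?_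
  rw [← Set.biUnion_preimage_singleton]
  exact s.toFinite.isClosed_biUnion fun e _ => h1 e

end Frame

namespace FrameArr

/-- The left action of an arrow of the semidirect product with `Aut T` on the bibundle of arrows
between frames. -/
def leftAct (g p : G.FrameArr T) (h : G.src p.arr = G.src g.arr) : G.FrameArr T :=
  mk (G.comp p.arr (G.inv g.arr)) g.tgt
    (by rw [src_comp (h.trans (G.tgt_inv _).symm), G.src_inv, g.base_tgt])

/-- The right action of `G` on the bibundle of arrows between frames. -/
def rightAct (p : G.FrameArr T) (g : G.Arr) (h : G.tgt p.arr = G.tgt g) : G.FrameArr T :=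
  mk (G.comp (G.inv g) p.arr) p.src
    (by rw [src_comp ((G.src_inv g).trans h.symm), p.src_arr])

lemma tgt_arr_leftAct (g p : G.FrameArr T) (h : G.src p.arr = G.src g.arr) :
    G.tgt (leftAct g p h).arr = G.tgt p.arr :=
  tgt_comp (h.trans (G.tgt_inv _).symm)

lemma tgt_arr_rightAct (p : G.FrameArr T) (g : G.Arr) (h : G.tgt p.arr = G.tgt g) :
    G.tgt (rightAct p g h).arr = G.src g :=
  (tgt_comp ((G.src_inv g).trans h.symm)).trans (G.tgt_inv g)

lemma _root_.Continuous.frameArrLeftAct {X : Type*} [TopologicalSpace X] {a b : X → G.FrameArr T}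
    (ha : Continuous a) (hb : Continuous b) (h : ∀ x, G.src (b x).arr = G.src (a x).arr) :
    Continuous (fun x => leftAct (a x) (b x) (h x)) :=
  ((continuous_arr.comp hb).groupoidComp (G.smooth_inv.continuous.comp (continuous_arr.comp ha))
    fun x => (h x).trans (G.tgt_inv _).symm).frameArrMk (continuous_tgt.comp ha) _

lemma _root_.Continuous.frameArrRightAct {X : Type*} [TopologicalSpace X] {a : X → G.FrameArr T}
    {b : X → G.Arr} (ha : Continuous a) (hb : Continuous b)
    (h : ∀ x, G.tgt (a x).arr = G.tgt (b x)) :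
    Continuous (fun x => rightAct (a x) (b x) (h x)) :=
  ((G.smooth_inv.continuous.comp hb).groupoidComp (continuous_arr.comp ha)
    fun x => (G.src_inv _).trans (h x).symm).frameArrMk (continuous_src.comp ha) _

/-- The arrow between frames that takes `p` to `q` under the left action, up to an automorphism
of `T`. -/
def leftDiv (q p : G.FrameArr T) (h : G.tgt q.arr = G.tgt p.arr) : G.FrameArr T :=
  mk (G.comp (G.inv q.arr) p.arr) (q.src.conj (G.comp (G.inv p.arr) q.arr)
    (by rw [src_comp ((G.src_inv _).trans h.symm), q.src_arr])) (by
      rw [src_comp ((G.src_inv _).trans h), Frame.base_conj,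
        tgt_comp ((G.src_inv _).trans h.symm), G.tgt_inv])

lemma base_src_leftDiv (q p : G.FrameArr T) (h : G.tgt q.arr = G.tgt p.arr) :
    (leftDiv q p h).src.base = p.src.base := by
  rw [leftDiv, src_mk, Frame.base_conj, tgt_comp ((G.src_inv _).trans h.symm), G.tgt_inv,
    p.src_arr]

lemma src_arr_leftDiv (q p : G.FrameArr T) (h : G.tgt q.arr = G.tgt p.arr) :
    G.src p.arr = G.src (leftDiv q p h).arr := by
  rw [src_arr, src_arr, base_src_leftDiv]

/-- The source frame of `leftDiv q p` is `q.src` transported along p⁻¹ q precisely so that the arrow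
q⁻¹ p brings it back to `q.src`. -/
lemma tgt_leftDiv (q p : G.FrameArr T) (h : G.tgt q.arr = G.tgt p.arr) :
    (leftDiv q p h).tgt = q.src := by
  have h1 : G.comp (G.comp (G.inv q.arr) p.arr) (G.comp (G.inv p.arr) q.arr) =
      G.unit q.src.base := by
    rw [comp_assoc ((G.src_inv _).trans h)
      (by rw [tgt_comp ((G.src_inv _).trans h.symm), G.tgt_inv]), comp_inv_cancel_left h.symm,
      inv_comp, q.src_arr]
  have h2 : G.src (G.comp (G.comp (G.inv q.arr) p.arr) (G.comp (G.inv p.arr) q.arr)) =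
      q.src.base := by rw [h1, G.src_unit]
  exact (Frame.conj_conj q.src (by rw [src_comp ((G.src_inv _).trans h.symm), q.src_arr])
    (leftDiv q p h).src_arr h2).trans
    ((Frame.conj_congr rfl h1 h2 (G.src_unit _)).trans (q.src.conj_unit _))

lemma leftAct_leftDiv (q p : G.FrameArr T) (h : G.tgt q.arr = G.tgt p.arr) :
    leftAct (leftDiv q p h) p (src_arr_leftDiv q p h) = q := by
  refine FrameArr.ext ?_ (tgt_leftDiv q p h)
  change G.comp p.arr (G.inv (G.comp (G.inv q.arr) p.arr)) = q.arr
  rw [inv_comp_rev ((G.src_inv _).trans h), inv_inv, comp_inv_cancel_left h.symm]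

lemma leftDiv_leftAct (g p : G.FrameArr T) (h : G.src p.arr = G.src g.arr) :
    leftDiv (leftAct g p h) p (tgt_arr_leftAct g p h) = g := by
  have h0 : G.src p.arr = G.tgt (G.inv g.arr) := h.trans (G.tgt_inv _).symm
  have h1 : G.comp (G.inv p.arr) (G.comp p.arr (G.inv g.arr)) = G.inv g.arr :=
    inv_comp_cancel_left h0
  refine FrameArr.ext ?_ ?_
  · change G.comp (G.inv (G.comp p.arr (G.inv g.arr))) p.arr = g.arr
    rw [inv_comp_rev h0, inv_inv, inv_comp_cancel_right h.symm]
  · have h2 : G.src (G.inv g.arr) = g.tgt.base := by rw [G.src_inv, base_tgt]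
    exact (Frame.conj_congr (φ := g.tgt) rfl h1
      ((congrArg G.src h1).trans h2) h2).trans
      (g.src.conj_inv_conj g.src_arr _)

lemma _root_.Continuous.frameArrLeftDiv {X : Type*} [TopologicalSpace X] {a b : X → G.FrameArr T}
    (ha : Continuous a) (hb : Continuous b) (h : ∀ x, G.tgt (a x).arr = G.tgt (b x).arr) :
    Continuous (fun x => leftDiv (a x) (b x) (h x)) :=
  Continuous.frameArrMk
    ((G.smooth_inv.continuous.comp (continuous_arr.comp ha)).groupoidComp (continuous_arr.comp hb)
      fun x => (G.src_inv _).trans (h x))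
    (((G.smooth_inv.continuous.comp (continuous_arr.comp hb)).groupoidComp (continuous_arr.comp ha)
      fun x => (G.src_inv _).trans (h x).symm).frameConj (continuous_src.comp ha) _) _

/-- The transported frame and `p.src` share a base point but need not coincide. The factor Aut(T) of
the semidirect product absorbs the difference. -/
lemma exists_leftDivAut (q p : G.FrameArr T) (h : G.tgt q.arr = G.tgt p.arr) :
    ∃ l : Disc (MulAut T), (leftDiv q p h).src.precomp l.out = p.src := by
  obtain ⟨e, he⟩ := (leftDiv q p h).src.exists_mulEquiv p.src (base_src_leftDiv q p h)
  exact ⟨e, Subtype.ext (funext he)⟩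

/-- The automorphism of `T` comparing the source frames of `leftDiv q p` and `p`. -/
def leftDivAut (q p : G.FrameArr T) (h : G.tgt q.arr = G.tgt p.arr) : Disc (MulAut T) :=
  (exists_leftDivAut q p h).choose

lemma precomp_leftDivAut (q p : G.FrameArr T) (h : G.tgt q.arr = G.tgt p.arr) :
    (leftDiv q p h).src.precomp (leftDivAut q p h).out = p.src :=
  (exists_leftDivAut q p h).choose_spec

end FrameArr

end Bibundle

/-! ### Smoothness and principality of the bibundle -/

section Equivalence

variable {G : SmoothGroupoid.{u}} [hG : G.IsOrbifold] {T : Type u} [Group T] [Finite T]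
  {EK : Type*} [NormedAddCommGroup EK] [NormedSpace ℝ EK] {HK : Type*} [TopologicalSpace HK]
  {IK : ModelWithCorners ℝ EK HK}
  {K : Type*} [TopologicalSpace K] [ChartedSpace HK K] [Group K] (α : G.RightAction IK K)
  (hPI : G.IsPurelyIneffective)

/-- Inversion is a diffeomorphism that exchanges source and target. -/
lemma IsEtale.isLocalDiffeomorph_tgt (G : SmoothGroupoid.{u}) [hG : G.IsEtale] :
    IsLocalDiffeomorph G.Arr.I G.Obj.I ∞ G.tgt := by
  let i : G.Arr ≃ₘ^∞⟮G.Arr.I, G.Arr.I⟯ G.Arr :=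
    { toFun := G.inv
      invFun := G.inv
      left_inv := inv_inv
      right_inv := inv_inv
      contMDiff_toFun := G.smooth_inv
      contMDiff_invFun := G.smooth_inv }
  have h : G.tgt = fun g => G.src (i g) := funext fun g => (G.src_inv g).symm
  rw [h]
  exact hG.etale.comp i.isLocalDiffeomorph

lemma isLocalDiffeomorph_frameArrArr :
    IsLocalDiffeomorph (M := frameArrMfd T hPI) (frameArrMfd T hPI).I G.Arr.I ∞ FrameArr.arr := by
  refine IsLocalDiffeomorph.of_comp (M := frameArrMfd T hPI) hG.etale FrameArr.continuous_arr ?_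
  rw [show (fun p : frameArrMfd T hPI => G.src (FrameArr.arr p)) =
    fun p : G.FrameArr T => p.src.base from funext FrameArr.src_arr]
  exact isLocalDiffeomorph_frameArrBase hPI

lemma isLocalDiffeomorph_tgt_frameArrArr :
    IsLocalDiffeomorph (M := frameArrMfd T hPI) (frameArrMfd T hPI).I G.Obj.I ∞
      (fun p : G.FrameArr T => G.tgt p.arr) :=
  (IsEtale.isLocalDiffeomorph_tgt G).comp (isLocalDiffeomorph_frameArrArr hPI)

variable (T) in
/-- The semidirect product of the frame groupoid with the automorphisms of `T`. -/
abbrev frameSemidirect : SmoothGroupoid.{u} := semidirect (frameAction T α hPI).snd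

/-- The new source frame lies over the target in `G` of the acting arrow. That target is a smooth
function on the whole ambient product, and it lifts along the étale base map. -/
lemma smoothOnSubset_leftAct :
    SmoothOnSubset (M := (frameArrMfd T hPI × Disc (MulAut T)) × frameArrMfd T hPI)
      (N := frameArrMfd T hPI)
      (((frameArrMfd T hPI).I.prod Disc.model).prod (frameArrMfd T hPI).I) (frameArrMfd T hPI).I
      {p : (G.FrameArr T × Disc (MulAut T)) × G.FrameArr T | p.1.1.src.act α (1, p.1.2) = p.2.src}
      (fun p => FrameArr.leftAct p.1.1.1 p.1.2 (FrameArr.src_arr_eq_of_act_eq α p.2)) := by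
  have hc : Continuous (fun p : {p : (G.FrameArr T × Disc (MulAut T)) × G.FrameArr T |
      p.1.1.src.act α (1, p.1.2) = p.2.src} =>
      FrameArr.leftAct p.1.1.1 p.1.2 (FrameArr.src_arr_eq_of_act_eq α p.2)) :=
    Continuous.frameArrLeftAct (continuous_fst.comp (continuous_fst.comp continuous_subtype_val))
      (continuous_snd.comp continuous_subtype_val) _
  exact smoothOnSubset_frameArrMfd
    (N := (frameArrMfd T hPI × Disc (MulAut T)) × frameArrMfd T hPI) hPI hc
    ((isLocalDiffeomorph_tgt_frameArrArr hPI).contMDiff.comp (contMDiff_fst.comp contMDiff_fst))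
    fun p => (FrameArr.base_tgt p.1.1.1).symm

lemma smoothOnSubset_rightAct :
    SmoothOnSubset (M := frameArrMfd T hPI × G.Arr) (N := frameArrMfd T hPI)
      ((frameArrMfd T hPI).I.prod G.Arr.I) (frameArrMfd T hPI).I
      {p : G.FrameArr T × G.Arr | G.tgt p.1.arr = G.tgt p.2}
      (fun p => FrameArr.rightAct p.1.1 p.1.2 p.2) := by
  have hc : Continuous (fun p : {p : G.FrameArr T × G.Arr | G.tgt p.1.arr = G.tgt p.2} =>
      FrameArr.rightAct p.1.1 p.1.2 p.2) :=
    Continuous.frameArrRightAct (continuous_fst.comp continuous_subtype_val)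
      (continuous_snd.comp continuous_subtype_val) _
  exact smoothOnSubset_frameArrMfd (N := frameArrMfd T hPI × G.Arr) hPI hc
    ((isLocalDiffeomorph_frameArrBase hPI).contMDiff.comp contMDiff_fst) fun _ => rfl

/-- The division map of the right action: h⁻¹ p = q has the unique solution h = p q⁻¹. -/
lemma smoothOnSubset_rightDiv :
    SmoothOnSubset (M := frameArrMfd T hPI × frameArrMfd T hPI)
      ((frameArrMfd T hPI).I.prod (frameArrMfd T hPI).I) G.Arr.I
      {p : G.FrameArr T × G.FrameArr T | p.1.src = p.2.src}
      (fun p => G.comp p.1.1.arr (G.inv p.1.2.arr)) := by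
  have h (p : {p : G.FrameArr T × G.FrameArr T | p.1.src = p.2.src}) :
      G.src p.1.1.arr = G.tgt (G.inv p.1.2.arr) := by
    rw [p.1.1.src_arr, G.tgt_inv, p.1.2.src_arr, show p.1.1.src = p.1.2.src from p.2]
  refine SmoothOnSubset.of_isLocalDiffeomorph (M := frameArrMfd T hPI × frameArrMfd T hPI)
    hG.etale ?_ ((isLocalDiffeomorph_tgt_frameArrArr hPI).contMDiff.comp contMDiff_snd)
    fun p => ((src_comp (h p)).trans (G.src_inv _)).symm
  exact Continuous.groupoidComp
    (FrameArr.continuous_arr.comp (continuous_fst.comp continuous_subtype_val))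
    (G.smooth_inv.continuous.comp
      (FrameArr.continuous_arr.comp (continuous_snd.comp continuous_subtype_val))) h

/-- The inverse of the left shear map. Its arrow component is a continuous lift of a smooth map
along an étale map, and its automorphism component is locally constant. -/
lemma smoothOnSubset_leftDiv :
    SmoothOnSubset (M := frameArrMfd T hPI × frameArrMfd T hPI)
      (N := frameArrMfd T hPI × Disc (MulAut T))
      ((frameArrMfd T hPI).I.prod (frameArrMfd T hPI).I) ((frameArrMfd T hPI).I.prod Disc.model)
      {p : G.FrameArr T × G.FrameArr T | G.tgt p.1.arr = G.tgt p.2.arr}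
      (fun p => (FrameArr.leftDiv p.1.1 p.1.2 p.2, FrameArr.leftDivAut p.1.1 p.1.2 p.2)) := by
  have hc : Continuous (fun p : {p : G.FrameArr T × G.FrameArr T | G.tgt p.1.arr = G.tgt p.2.arr} =>
      FrameArr.leftDiv p.1.1 p.1.2 p.2) :=
    Continuous.frameArrLeftDiv (continuous_fst.comp continuous_subtype_val)
      (continuous_snd.comp continuous_subtype_val) _
  refine SmoothOnSubset.prodMk (M := frameArrMfd T hPI × frameArrMfd T hPI)
    (N := frameArrMfd T hPI) ?_ ?_
  · exact smoothOnSubset_frameArrMfd (N := frameArrMfd T hPI × frameArrMfd T hPI) hPI hc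
      ((isLocalDiffeomorph_frameArrBase hPI).contMDiff.comp contMDiff_snd)
      fun p => (FrameArr.base_src_leftDiv p.1.1 p.1.2 p.2).symm
  · refine SmoothOnSubset.of_disc (M := frameArrMfd T hPI × frameArrMfd T hPI) ?_
    exact Frame.continuous_of_precomp_eq (FrameArr.continuous_src.comp hc)
      (FrameArr.continuous_src.comp (continuous_snd.comp continuous_subtype_val))
      fun p => FrameArr.precomp_leftDivAut p.1.1 p.1.2 p.2

variable (T) in
/-- The left action of the semidirect product on the bibundle. -/
def frameLeftSpace : (frameSemidirect T α hPI).LeftSpace (frameArrMfd T hPI) where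
  base := FrameArr.src
  act g p e := FrameArr.leftAct g.1 p (FrameArr.src_arr_eq_of_act_eq α e)
  smooth_base := (isLocalDiffeomorph_frameArrSrc hPI).contMDiff
  smooth_act := smoothOnSubset_leftAct α hPI
  base_act _ _ _ := rfl
  unit_act (p : G.FrameArr T) := by
    refine FrameArr.ext ?_ (FrameArr.tgt_unit _)
    change G.comp p.arr (G.inv (G.unit p.src.base)) = p.arr
    rw [inv_unit, comp_unit p.src_arr]
  act_act (g : G.FrameArr T × Disc (MulAut T)) (h : G.FrameArr T × Disc (MulAut T))
      (p : G.FrameArr T) (e : g.1.src.act α (1, g.2) = h.1.tgt) e' := by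
    have h1 : G.src p.arr = G.src h.1.arr := FrameArr.src_arr_eq_of_act_eq α e'
    have h2 : G.src g.1.arr = G.tgt h.1.arr := by
      rw [← h.1.base_tgt, ← e, Frame.base_act, α.obj_one, g.1.src_arr]
    -- The composite in the semidirect product twists `h.1` by the inverse of `g.2`. This leaves its
    -- arrow in `G` unchanged and makes its target frame equal to the source frame of `g.1`.
    refine FrameArr.ext ?_ (FrameArr.tgt_mul g.1 (h.1.act α (1, g.2⁻¹)) ?_).symm
    · change G.comp (G.comp p.arr (G.inv h.1.arr)) (G.inv g.1.arr) =
        G.comp p.arr (G.inv (G.comp g.1.arr (α.arr h.1.arr 1)))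
      rw [α.arr_one, inv_comp_rev h2, comp_assoc (h1.trans (G.tgt_inv _).symm)
        (by rw [G.src_inv, G.tgt_inv, h2])]
    · rw [FrameArr.tgt_act, ← e, ← Frame.act_mul]
      simp only [Prod.mk_mul_mk, mul_one, mul_inv_cancel]
      exact (Frame.act_one α _).symm

variable (T) in
/-- The right action of `G` on the bibundle. -/
def frameRightSpace : G.RightSpace (frameArrMfd T hPI) where
  base p := G.tgt (FrameArr.arr p)
  act := FrameArr.rightAct
  smooth_base := (isLocalDiffeomorph_tgt_frameArrArr hPI).contMDiff
  smooth_act := smoothOnSubset_rightAct hPI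
  base_act := FrameArr.tgt_arr_rightAct
  act_unit (p : G.FrameArr T) := by
    refine FrameArr.ext ?_ rfl
    change G.comp (G.inv (G.unit (G.tgt p.arr))) p.arr = p.arr
    rw [inv_unit, unit_comp rfl]
  act_act (p : G.FrameArr T) g h e e' := by
    refine FrameArr.ext ?_ rfl
    change G.comp (G.inv h) (G.comp (G.inv g) p.arr) = G.comp (G.inv (G.mul g h e')) p.arr
    rw [mul_eq_comp, inv_comp_rev e', comp_assoc (by rw [G.src_inv, G.tgt_inv, e'])
      ((G.src_inv _).trans e.symm)]

/-- Two elements over the same frame are arrows of `G` with a common source, so exactly one right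
translation relates them. Units give surjectivity. -/
lemma isPrincipal_frameRightSpace :
    (frameRightSpace T hPI).IsPrincipal (B := frameMfd T hPI) FrameArr.src := by
  refine ⟨fun φ => ⟨FrameArr.unit φ, rfl⟩, (isLocalDiffeomorph_frameArrSrc hPI).isSmoothSubmersion,
    fun _ _ _ => rfl, ?_⟩
  have h (q : {q : G.FrameArr T × G.FrameArr T | q.1.src = q.2.src}) :
      G.src q.1.1.arr = G.src q.1.2.arr := by
    rw [q.1.1.src_arr, q.1.2.src_arr, show q.1.1.src = q.1.2.src from q.2]
  let e : {q : G.FrameArr T × G.Arr | G.tgt q.1.arr = G.tgt q.2} ≃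
      {q : G.FrameArr T × G.FrameArr T | q.1.src = q.2.src} :=
    { toFun := fun q => ⟨(q.1.1, FrameArr.rightAct q.1.1 q.1.2 q.2), rfl⟩
      invFun := fun q => ⟨(q.1.1, G.comp q.1.1.arr (G.inv q.1.2.arr)),
        (tgt_comp ((h q).trans (G.tgt_inv _).symm)).symm⟩
      left_inv := fun q => by
        refine Subtype.ext (Prod.ext rfl ?_)
        change G.comp q.1.1.arr (G.inv (G.comp (G.inv q.1.2) q.1.1.arr)) = q.1.2
        rw [inv_comp_rev ((G.src_inv _).trans q.2.symm), inv_inv, comp_inv_cancel_left q.2]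
      right_inv := fun q => by
        refine Subtype.ext (Prod.ext rfl (FrameArr.ext ?_ q.2))
        change G.comp (G.inv (G.comp q.1.1.arr (G.inv q.1.2.arr))) q.1.1.arr = q.1.2.arr
        rw [inv_comp_rev ((h q).trans (G.tgt_inv _).symm), inv_inv,
          inv_comp_cancel_right (h q).symm] }
  refine ⟨e, fun _ => rfl, ?_, ?_⟩
  · exact SmoothOnSubset.prodMk (M := frameArrMfd T hPI × G.Arr) (N := frameArrMfd T hPI)
      (B := frameArrMfd T hPI) (SmoothOnSubset.of_contMDiff contMDiff_fst fun _ => rfl)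
      (smoothOnSubset_rightAct hPI)
  · exact SmoothOnSubset.prodMk (M := frameArrMfd T hPI × frameArrMfd T hPI)
      (N := frameArrMfd T hPI) (SmoothOnSubset.of_contMDiff contMDiff_fst fun _ => rfl)
      (smoothOnSubset_rightDiv hPI)

variable (T) in
/-- The bibundle from the semidirect product to `G`. -/
def frameMorphism : (frameSemidirect T α hPI).HSMorphism G where
  P := frameArrMfd T hPI
  left := frameLeftSpace T α hPI
  right := frameRightSpace T hPI
  src_invariant _ _ _ := rfl
  tgt_invariant _ _ e := FrameArr.tgt_arr_leftAct _ _ (FrameArr.src_arr_eq_of_act_eq α e)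
  act_comm _ (p : G.FrameArr T) h e (e' : G.tgt p.arr = G.tgt h) := FrameArr.ext
    (comp_assoc ((G.src_inv h).trans e'.symm)
      ((FrameArr.src_arr_eq_of_act_eq α e).trans (G.tgt_inv _).symm)).symm rfl
  principal := isPrincipal_frameRightSpace hPI

/-- For p and q with the same target in `G`, the arrow q⁻¹ p and the automorphism comparing source
frames form the unique element carrying p to q. Frames over every object are needed only for
surjectivity onto the objects of `G`. -/
lemma isEquivalence_frameMorphism (hsurj : Function.Surjective (Frame.base : G.Frame T → G.Obj)) :
    (frameMorphism T α hPI).IsEquivalence := by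
  refine ⟨fun y => ?_, (isLocalDiffeomorph_tgt_frameArrArr hPI).isSmoothSubmersion,
    (frameMorphism T α hPI).tgt_invariant, ?_⟩
  · obtain ⟨φ, rfl⟩ := hsurj y
    exact ⟨FrameArr.unit φ, G.tgt_unit _⟩
  let e : {q : (G.FrameArr T × Disc (MulAut T)) × G.FrameArr T |
        q.1.1.src.act α (1, q.1.2) = q.2.src} ≃
      {q : G.FrameArr T × G.FrameArr T | G.tgt q.1.arr = G.tgt q.2.arr} :=
    { toFun := fun q => ⟨(FrameArr.leftAct q.1.1.1 q.1.2 (FrameArr.src_arr_eq_of_act_eq α q.2),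
        q.1.2), FrameArr.tgt_arr_leftAct _ _ (FrameArr.src_arr_eq_of_act_eq α q.2)⟩
      invFun := fun q => ⟨((FrameArr.leftDiv q.1.1 q.1.2 q.2,
        FrameArr.leftDivAut q.1.1 q.1.2 q.2), q.1.2), by
          refine (Frame.act_one_left α _ _).trans ?_
          exact FrameArr.precomp_leftDivAut q.1.1 q.1.2 q.2⟩
      left_inv := fun q => by
        have h := FrameArr.src_arr_eq_of_act_eq α q.2
        have h1 := FrameArr.leftDiv_leftAct q.1.1.1 q.1.2 h
        refine Subtype.ext (Prod.ext (Prod.ext h1 ?_) rfl)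
        -- The automorphism was obtained by choice; freeness of Aut(T) on frames identifies it with
        -- the given one.
        refine q.1.1.1.src.precomp_injective ?_
        have h2 := FrameArr.precomp_leftDivAut (FrameArr.leftAct q.1.1.1 q.1.2 h) q.1.2
          (FrameArr.tgt_arr_leftAct _ _ _)
        rw [h1] at h2
        exact h2.trans (q.2.symm.trans (Frame.act_one_left α _ _))
      right_inv := fun q => Subtype.ext (Prod.ext (FrameArr.leftAct_leftDiv _ _ q.2) rfl) }
  refine ⟨e, fun _ => rfl, ?_, ?_⟩
  · have h := (smoothOnSubset_leftAct (T := T) α hPI).prodMk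
      (SmoothOnSubset.of_contMDiff (f := fun p => p.1.2) contMDiff_snd fun _ => rfl)
    exact h
  · have h := (smoothOnSubset_leftDiv (T := T) hPI).prodMk
      (SmoothOnSubset.of_contMDiff (f := fun p => p.1.2) contMDiff_snd fun _ => rfl)
    exact h

variable (T) in
/-- The bibundle from the semidirect product to `G` is `K`-equivariant. -/
def frameEquivariance :
    (frameMorphism T α hPI).Equivariance (frameAction T α hPI).onSemidirect α where
  act p k := FrameArr.act α p (k, 1)
  act_one := (frameAction T α hPI).arr_one
  act_mul := (frameAction T α hPI).fst.arr_mul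
  smooth_act := (frameAction T α hPI).fst.smooth_arr
  left_base _ _ := rfl
  right_base _ _ := α.tgt_act _ _
  left_act g (p : G.FrameArr T) e k := by
    refine FrameArr.ext ?_ (FrameArr.tgt_act α _ _).symm
    have h : G.src p.arr = G.src (FrameArr.arr g.1) := FrameArr.src_arr_eq_of_act_eq α e
    change α.arr (G.comp p.arr (G.inv (FrameArr.arr g.1))) k =
      G.comp (α.arr p.arr k) (G.inv (α.arr (FrameArr.arr g.1) k))
    rw [α.comp_act (h.trans (G.tgt_inv _).symm), α.inv_act]
  right_act (p : G.FrameArr T) h (e : G.tgt p.arr = G.tgt h) k := by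
    refine FrameArr.ext ?_ rfl
    change α.arr (G.comp (G.inv h) p.arr) k = G.comp (G.inv (α.arr h k)) (α.arr p.arr k)
    rw [α.comp_act ((G.src_inv _).trans e.symm), α.inv_act]

end Equivalence

end SmoothGroupoid

end

/-! ### The proposition -/

theorem mainTheorem6
    {EK : Type*} [NormedAddCommGroup EK] [NormedSpace ℝ EK] [FiniteDimensional ℝ EK]
    {HK : Type*} [TopologicalSpace HK] {IK : ModelWithCorners ℝ EK HK} [IK.Boundaryless]
    {K : Type*} [TopologicalSpace K] [ChartedSpace HK K] [Group K] [LieGroup IK ∞ K]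
    [T2Space K] [SecondCountableTopology K]
    (G : SmoothGroupoid.{u}) [G.IsOrbifold] (hconn : G.IsConnected)
    (hPI : G.IsPurelyIneffective) (α : G.RightAction IK K) (x : G.Obj) :
    ∃ (G' : SmoothGroupoid.{u}) (_ : G'.IsOrbifold)
      (β : G'.RightAction (IK.prod Disc.model) (K × Disc (MulAut (G.ineffStab x)))),
      G'.IsPurelyIneffective ∧
      SmoothGroupoid.EquivariantlyEquivalent β.onSemidirect α ∧
      Nonempty (SmoothGroupoid.StabilizerTrivialization β
        (Subgroup.center (G.ineffStab x))
        (fun a kl => Subgroup.centerCongr (kl.2 : MulAut (G.ineffStab x))⁻¹ a)) ∧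
      (∀ (y : G'.Obj) (a b : G'.ineffStab y), a * b = b * a) ∧
      Nonempty (SmoothGroupoid.StabilizerTrivialization β.fst
        (Subgroup.center (G.ineffStab x)) (fun a _ => a)) := by
  -- Frames are isomorphisms onto full stabilizers. Pure ineffectiveness makes the ineffective
  -- stabilizer at `x` full, so the tautological frame becomes a T-frame at `x`, from which
  -- connectedness spreads frames to all objects.
  have htop : G.ineffStab x = ⊤ := by
    refine (Subgroup.eq_top_iff' _).2 fun a => ?_
    change a.arr ∈ G.ineffectiveSpace
    rw [hPI]
    exact a.src_eq.trans a.tgt_eq.symm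
  have hsurj := SmoothGroupoid.Frame.surjective_base hconn hPI
    ((SmoothGroupoid.Frame.ofStab x).precomp
      ((MulEquiv.subgroupCongr htop).trans Subgroup.topEquiv))
  have c := SmoothGroupoid.frameTrivialization (G.ineffStab x) α hPI
  refine ⟨SmoothGroupoid.frameGroupoid (G.ineffStab x) hPI, inferInstance,
    SmoothGroupoid.frameAction (G.ineffStab x) α hPI,
    SmoothGroupoid.isPurelyIneffective_frameGroupoid hPI,
    ⟨SmoothGroupoid.frameMorphism _ α hPI, SmoothGroupoid.isEquivalence_frameMorphism α hPI hsurj,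
      ⟨SmoothGroupoid.frameEquivariance _ α hPI⟩⟩, ⟨c⟩,
    c.ineffStab_comm fun a b => Subtype.ext (Subgroup.mem_center_iff.1 b.2 a.1),
    ⟨c.fst _ fun a k => ?_⟩⟩
  -- Elements `(k, 1)` act on the center through the identity automorphism.
  exact Subtype.ext rfl
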